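/- Let $R$ be a nonzero commutative ring whose only idempotents are $0$ and $1$, and let $X$ be a metric space. A subset of $X$ is called locally finite if it has finite intersection with every bounded subset of $X$. A quantum spin system on $X$ is a function $q : X \to \mathbb{N}_{>0}$ such that $\{x : q_x > 1\}$ is locally finite. Its algebra of local observables is $\mathcal{A}(X,q) = \varinjlim_{\Gamma} \bigotimes_{x\in\Gamma} \mathrm{Mat}(R^{q_x})$, the direct limit over the finite subsets $\Gamma \subset X$ along the inclusions $a \mapsto a \otimes 1$, where $\mathrm{Mat}(R^n)$ denotes the $n \times n$ matrices over $R$; for $Y \subset X$, $\mathcal{A}(Y,q)$ is the subalgebra of elements coming from finite $\Gamma \subset Y$. A locality-preserving isomorphism $\mathcal{A}(X,q) \to \mathcal{A}(X,r)$ is an $R$-algebra isomorphism $\alpha$ for which there is $l>0$ such that $\alpha(\mathcal{A}(\{x\},q)) \subset \mathcal{A}(\{y : d(x,y) \le l\}, r)$ for all $x \in X$. Let $\mathbf{C}(X)$ be the category of quantum spin systems and locality-preserving isomorphisms. The pointwise product $(qr)_x = q_x r_x$, with $\mathcal{A}(X,q)\otimes\mathcal{A}(X,r) \cong \mathcal{A}(X,qr)$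 by the pointwise Kronecker product, makes the isomorphism classes of objects of $\mathbf{C}(X)$ into a commutative monoid; $K_0(\mathbf{C}(X))$ is its group completion. For an abelian group $A$, let $CC_0(X,A)$ be the group of formal sums $\sum_x a_x [x]$ with $a_x \in A$ and $\{x : a_x \ne 0\}$ locally finite, and let $CC_1(X,A)$ be the group of formal sums $\sum a_{(x_0,x_1)}[x_0,x_1]$ over pairs in $X^2$ such that every bounded subset of $X$ contains a component of only finitely many terms with nonzero coefficient, and such that for some $l > 0$ all these terms lie in the $l$-neighbourhood of the diagonal of $X^2$ (with the maximum metric). Let $\partial : CC_1(X,A) \to CC_0(X,A)$ be the locally finite extension of $\partial[x_0,x_1] = [x_1]-[x_0]$, and let $CH_0(X,A) = CC_0(X,A)/\operatorname{im}\partial$ be the $0$-th coarse homology group. Theorem. There is an isomorphism of groups $K_0(\mathbf{C}(X)) \cong CH_0(X, \mathbb{Z}^{\oplus\omega})$, where $\mathbb{Z}^{\oplus\omega}$ is the direct sum of countably many copies of $\mathbb{Z}$. -/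

import Mathlib

universe u v w

open scoped TensorProduct

noncomputable section

namespace QuantumSpin

/-! ### Tensor products of families of algebras -/

section Finite

variable {R : Type u} [CommRing R] {ι : Type v} {A : ι → Type w} [∀ i, Ring (A i)]
  [∀ i, Algebra R (A i)]

/-- The inclusion `a ↦ 1 ⊗ ⋯ ⊗ a ⊗ ⋯ ⊗ 1` of the factor `Aᵢ` in `⨂ᵢ Aᵢ`. -/
def single (i : ι) : A i →ₐ[R] ⨂[R] j, A j :=
  letI := Classical.decEq ι
  PiTensorProduct.singleAlgHom i

theorem single_apply [DecidableEq ι] (i : ι) (a : A i) :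
    single (R := R) i a = PiTensorProduct.tprod R (Pi.mulSingle i a) := by
  simp only [single, PiTensorProduct.singleAlgHom_apply, MonoidHom.mulSingle_apply]
  congr!

theorem commute_single {i j : ι} (h : i ≠ j) (a : A i) (b : A j) :
    Commute (single (R := R) (A := A) i a) (single (R := R) (A := A) j b) := by
  classical
  rw [single_apply, single_apply]
  exact (Pi.mulSingle_commute h a b).tprod

theorem algHom_ext {S : Type*} [Ring S] [Algebra R S] [Finite ι]
    {f g : (⨂[R] i, A i) →ₐ[R] S} (h : ∀ i a, f (single i a) = g (single i a)) : f = g := by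
  classical
  apply PiTensorProduct.algHom_ext
  intro i
  ext a
  have := h i a
  simp only [single_apply] at this
  simpa using this

variable [Fintype ι] {S : Type*} [Ring S] [Algebra R S]

/-- The multiplicative map `(aᵢ) ↦ ∏ᵢ fᵢ aᵢ` attached to a pairwise commuting family `f`. -/
def prodHom (f : ∀ i, A i →ₐ[R] S)
    (hf : Pairwise fun i j => ∀ a b, Commute (f i a) (f j b)) : (∀ i, A i) →* S :=
  MonoidHom.noncommPiCoprod (fun i => (f i : A i →* S)) hf

theorem prodHom_mulSingle [DecidableEq ι] (f : ∀ i, A i →ₐ[R] S)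
    (hf : Pairwise fun i j => ∀ a b, Commute (f i a) (f j b)) (i : ι) (a : A i) :
    prodHom f hf (Pi.mulSingle i a) = f i a :=
  MonoidHom.noncommPiCoprod_mulSingle (hcomm := hf) (fun i => (f i : A i →* S)) i a

theorem prodHom_update [DecidableEq ι] (f : ∀ i, A i →ₐ[R] S)
    (hf : Pairwise fun i j => ∀ a b, Commute (f i a) (f j b)) (v : ∀ i, A i) (i : ι) (a : A i) :
    prodHom f hf (Function.update v i a) = f i a * prodHom f hf (Function.update v i 1) := by
  have h : Function.update v i a = Pi.mulSingle i a * Function.update v i 1 := by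
    funext j
    by_cases hj : j = i
    · subst hj; simp
    · simp [hj]
  rw [h, map_mul, prodHom_mulSingle]

/-- A finite family of algebra homomorphisms `Aᵢ → S` with pairwise commuting images
induces an algebra homomorphism `⨂ᵢ Aᵢ → S`. -/
def liftFin (f : ∀ i, A i →ₐ[R] S)
    (hf : Pairwise fun i j => ∀ a b, Commute (f i a) (f j b)) : (⨂[R] i, A i) →ₐ[R] S :=
  PiTensorProduct.liftAlgHom
    { toFun := prodHom f hf
      map_update_add' := by
        intro _ v i a b
        rw [prodHom_update f hf v i a, prodHom_update f hf v i b, prodHom_update f hf v i (a + b),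
          map_add, add_mul]
      map_update_smul' := by
        intro _ v i c a
        rw [prodHom_update f hf v i a, prodHom_update f hf v i (c • a), map_smul, smul_mul_assoc] }
    (map_one (prodHom f hf)) (map_mul (prodHom f hf))

theorem liftFin_single (f : ∀ i, A i →ₐ[R] S)
    (hf : Pairwise fun i j => ∀ a b, Commute (f i a) (f j b)) (i : ι) (a : A i) :
    liftFin f hf (single i a) = f i a := by
  classical
  rw [single_apply, liftFin, PiTensorProduct.liftAlgHom_apply, PiTensorProduct.lift.tprod]
  exact prodHom_mulSingle f hf i a

end Finite

section Infinite

variable (R : Type u) [CommRing R] {X : Type v} (A : X → Type w) [∀ x, Ring (A x)]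
  [∀ x, Algebra R (A x)]

/-- The finite tensor product `⨂_{x ∈ Γ} A x`. -/
abbrev FinTensor (Γ : Finset X) : Type (max u v w) := ⨂[R] x : Γ, A x

/-- The inclusion of the tensor factor `A x` in `⨂_{x ∈ Γ} A x`. -/
def factor (Γ : Finset X) (x : X) (hx : x ∈ Γ) : A x →ₐ[R] FinTensor R A Γ :=
  single (A := fun z : Γ => A z) ⟨x, hx⟩

theorem commute_factor (Γ : Finset X) {x y : X} (h : x ≠ y) (hx : x ∈ Γ) (hy : y ∈ Γ)
    (a : A x) (b : A y) : Commute (factor R A Γ x hx a) (factor R A Γ y hy b) :=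
  commute_single (A := fun z : Γ => A z) (i := ⟨x, hx⟩) (j := ⟨y, hy⟩)
    (fun e => h (congrArg Subtype.val e)) a b

variable {R A} in
theorem finTensor_ext {Γ : Finset X} {S : Type*} [Ring S] [Algebra R S]
    {f g : FinTensor R A Γ →ₐ[R] S}
    (h : ∀ x hx a, f (factor R A Γ x hx a) = g (factor R A Γ x hx a)) : f = g :=
  algHom_ext fun x a => h x x.2 a

/-- The inclusion `a ↦ a ⊗ 1` of `⨂_{x ∈ Γ} A x` in `⨂_{x ∈ Γ'} A x` for `Γ ⊆ Γ'`: the algebra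
homomorphism sending each tensor factor `A x`, `x ∈ Γ`, identically to the factor `A x`. -/
def incl (Γ Γ' : Finset X) (h : Γ ≤ Γ') : FinTensor R A Γ →ₐ[R] FinTensor R A Γ' :=
  liftFin (fun x : Γ => factor R A Γ' x (h x.2))
    fun _ _ hxy => commute_factor R A Γ' (fun e => hxy (Subtype.ext e)) _ _

theorem incl_factor {Γ Γ' : Finset X} (h : Γ ≤ Γ') (x : X) (hx : x ∈ Γ) (a : A x) :
    incl R A Γ Γ' h (factor R A Γ x hx a) = factor R A Γ' x (h hx) a :=
  liftFin_single (fun x : Γ => factor R A Γ' x (h x.2)) _ ⟨x, hx⟩ a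

instance : DirectedSystem (FinTensor R A) (incl R A · · ·) where
  map_self Γ a := by
    have : incl R A Γ Γ le_rfl = AlgHom.id R _ :=
      finTensor_ext fun x hx a => incl_factor R A _ x hx a
    exact DFunLike.congr_fun this a
  map_map Γ'' Γ' Γ h h' a := by
    have : (incl R A Γ' Γ'' h').comp (incl R A Γ Γ' h) = incl R A Γ Γ'' (h.trans h') :=
      finTensor_ext fun x hx a => by
        rw [AlgHom.comp_apply, incl_factor, incl_factor, incl_factor]
    exact DFunLike.congr_fun this a

instance : IsDirectedOrder (Finset X) := by
  classical
  infer_instance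

/-- The (restricted) tensor product `⨂_{x ∈ X} A x`: the direct limit of the tensor products over
finite subsets of `X` along the inclusions `a ↦ a ⊗ 1`. -/
def InfTensor : Type (max u v w) := DirectLimit (FinTensor R A) (incl R A)

instance : Ring (InfTensor R A) :=
  inferInstanceAs (Ring (DirectLimit (FinTensor R A) (incl R A)))

instance : Algebra R (InfTensor R A) :=
  inferInstanceAs (Algebra R (DirectLimit (FinTensor R A) (incl R A)))

/-- The canonical map `⨂_{x ∈ Γ} A x → ⨂_{x ∈ X} A x`. -/
def ofFin (Γ : Finset X) : FinTensor R A Γ →ₐ[R] InfTensor R A :=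
  DirectLimit.Algebra.of (FinTensor R A) (incl R A) Γ

theorem ofFin_incl {Γ Γ' : Finset X} (h : Γ ≤ Γ') (a : FinTensor R A Γ) :
    ofFin R A Γ' (incl R A Γ Γ' h a) = ofFin R A Γ a :=
  DirectLimit.Algebra.of_f h a

/-- The inclusion of the tensor factor `A x` in `⨂_{x ∈ X} A x`. -/
def site (x : X) : A x →ₐ[R] InfTensor R A :=
  (ofFin R A {x}).comp (factor R A {x} x (Finset.mem_singleton_self x))

/-- The subalgebra of elements supported on `Y`: the union of the images of the tensor products
over the finite subsets of `Y`. -/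
def supportedOn (Y : Set X) : Subalgebra R (InfTensor R A) :=
  ⨆ (Γ : Finset X) (_ : (Γ : Set X) ⊆ Y), (ofFin R A Γ).range

theorem ofFin_factor (Γ : Finset X) (x : X) (hx : x ∈ Γ) (a : A x) :
    ofFin R A Γ (factor R A Γ x hx a) = site R A x a := by
  have h : ({x} : Finset X) ≤ Γ := Finset.singleton_subset_iff.2 hx
  rw [← incl_factor R A h x (Finset.mem_singleton_self x) a, ofFin_incl]
  rfl

theorem commute_site {x y : X} (h : x ≠ y) (a : A x) (b : A y) :
    Commute (site R A x a) (site R A y b) := by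
  classical
  rw [← ofFin_factor R A {x, y} x (by simp), ← ofFin_factor R A {x, y} y (by simp)]
  exact (commute_factor R A _ h _ _ a b).map (ofFin R A {x, y})

variable {R A} in
theorem infTensor_ext {S : Type*} [Ring S] [Algebra R S] {f g : InfTensor R A →ₐ[R] S}
    (h : ∀ x a, f (site R A x a) = g (site R A x a)) : f = g := by
  apply DirectLimit.Algebra.hom_ext
  intro Γ
  refine finTensor_ext fun x hx a => ?_
  have := h x a
  rw [← ofFin_factor R A Γ x hx] at this
  exact this

variable {R A} in
/-- A family of algebra homomorphisms `A x → S` with pairwise commuting images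
induces an algebra homomorphism `⨂_{x ∈ X} A x → S`. -/
def liftInf {S : Type*} [Ring S] [Algebra R S] (f : ∀ x, A x →ₐ[R] S)
    (hf : Pairwise fun x y => ∀ a b, Commute (f x a) (f y b)) : InfTensor R A →ₐ[R] S :=
  DirectLimit.Algebra.lift (FinTensor R A) (incl R A) S
    (fun Γ => liftFin (fun x : Γ => f x) fun _ _ h => hf fun e => h (Subtype.ext e))
    (fun Γ Γ' h a => by
      have : (liftFin (fun x : Γ' => f x) fun _ _ h => hf fun e => h (Subtype.ext e)).comp
          (incl R A Γ Γ' h) =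
          liftFin (fun x : Γ => f x) fun _ _ h => hf fun e => h (Subtype.ext e) :=
        finTensor_ext fun x hx a => by
          rw [AlgHom.comp_apply, incl_factor]
          exact (liftFin_single (fun x : Γ' => f x) _ ⟨x, h hx⟩ a).trans
            (liftFin_single (fun x : Γ => f x) _ ⟨x, hx⟩ a).symm
      exact DFunLike.congr_fun this a)

theorem liftInf_site {S : Type*} [Ring S] [Algebra R S] (f : ∀ x, A x →ₐ[R] S)
    (hf : Pairwise fun x y => ∀ a b, Commute (f x a) (f y b)) (x : X) (a : A x) :
    liftInf f hf (site R A x a) = f x a :=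
  liftFin_single (fun z : ({x} : Finset X) => f z) _ ⟨x, Finset.mem_singleton_self x⟩ a

theorem range_site_le {Y : Set X} {x : X} (hx : x ∈ Y) :
    (site R A x).range ≤ supportedOn R A Y := by
  have h : (((({x} : Finset X)) : Set X)) ⊆ Y := by simpa using hx
  refine le_trans ?_ (le_iSup₂_of_le (f := fun (Γ : Finset X) (_ : (Γ : Set X) ⊆ Y) =>
    (ofFin R A Γ).range) {x} h le_rfl)
  exact AlgHom.range_comp_le_range _ _

theorem supportedOn_mono {Y Z : Set X} (h : Y ⊆ Z) : supportedOn R A Y ≤ supportedOn R A Z :=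
  iSup₂_le fun Γ hΓ => le_iSup₂_of_le (f := fun (Γ : Finset X) (_ : (Γ : Set X) ⊆ Z) =>
    (ofFin R A Γ).range) Γ (hΓ.trans h) le_rfl

theorem supportedOn_le {Y : Set X} {B : Subalgebra R (InfTensor R A)}
    (h : ∀ x ∈ Y, (site R A x).range ≤ B) : supportedOn R A Y ≤ B := by
  refine iSup₂_le fun Γ hΓ => ?_
  have : ofFin R A Γ = B.val.comp (liftFin
      (fun x : Γ => (site R A (x : X)).codRestrict B
        fun a => h x (hΓ (Finset.mem_coe.2 x.2)) ⟨a, rfl⟩)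
      fun x y hxy a b => Subtype.ext
        (commute_site R A (fun e => hxy (Subtype.ext e)) a b)) := by
    refine finTensor_ext fun x hx a => ?_
    rw [ofFin_factor]
    exact (congrArg B.val (liftFin_single (fun x : Γ => (site R A (x : X)).codRestrict B
      fun a => h x (hΓ (Finset.mem_coe.2 x.2)) ⟨a, rfl⟩) _ ⟨x, hx⟩ a)).symm
  rw [this]
  rintro _ ⟨a, rfl⟩
  exact Subtype.property _

end Infinite

/-! ### Stacking -/

section Stacking

variable {R : Type u} [CommRing R] {X : Type v} {A B C : X → Type w} [∀ x, Ring (A x)]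
  [∀ x, Algebra R (A x)] [∀ x, Ring (B x)] [∀ x, Algebra R (B x)] [∀ x, Ring (C x)]
  [∀ x, Algebra R (C x)]

theorem mem_of_range_site_le (D : Subalgebra R (InfTensor R A))
    (h : ∀ x, (site R A x).range ≤ D) (a : InfTensor R A) : a ∈ D := by
  have hc : Pairwise fun x y => ∀ a b,
      Commute ((site R A x).codRestrict D (fun a => h x ⟨a, rfl⟩) a)
        ((site R A y).codRestrict D (fun a => h y ⟨a, rfl⟩) b) :=
    fun x y hxy a b => Subtype.ext (commute_site R A hxy a b)
  have : AlgHom.id R (InfTensor R A) = D.val.comp (liftInf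
      (fun x => (site R A x).codRestrict D fun a => h x ⟨a, rfl⟩) hc) :=
    infTensor_ext fun x a => (congrArg D.val (liftInf_site R A _ hc x a)).symm
  have h2 := DFunLike.congr_fun this a
  rw [AlgHom.id_apply] at h2
  rw [h2]
  exact Subtype.property _

theorem commute_of_commute_site {S : Type*} [Ring S] [Algebra R S] (f : InfTensor R A →ₐ[R] S)
    (g : InfTensor R B →ₐ[R] S)
    (h : ∀ x y a b, Commute (f (site R A x a)) (g (site R B y b)))
    (a : InfTensor R A) (b : InfTensor R B) : Commute (f a) (g b) := by
  have h1 : ∀ x (a : A x) (b : InfTensor R B), Commute (f (site R A x a)) (g b) := by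
    intro x a b
    have := mem_of_range_site_le ((Subalgebra.centralizer R {f (site R A x a)}).comap g)
      (by
        rintro y _ ⟨b, rfl⟩
        rw [Subalgebra.mem_comap, Subalgebra.mem_centralizer_iff]
        rintro _ rfl
        exact h x y a b) b
    rw [Subalgebra.mem_comap, Subalgebra.mem_centralizer_iff] at this
    exact this _ rfl
  have := mem_of_range_site_le ((Subalgebra.centralizer R {g b}).comap f)
    (by
      rintro x _ ⟨a, rfl⟩
      rw [Subalgebra.mem_comap, Subalgebra.mem_centralizer_iff]
      rintro _ rfl
      exact (h1 x a b).symm) a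
  rw [Subalgebra.mem_comap, Subalgebra.mem_centralizer_iff] at this
  exact (this _ rfl).symm

variable (φ : ∀ x, A x ⊗[R] B x ≃ₐ[R] C x)

/-- The homomorphism `⨂ A x → ⨂ C x` given at `x` by `a ↦ φ_x (a ⊗ 1)`. -/
def stackLeft : InfTensor R A →ₐ[R] InfTensor R C :=
  liftInf (fun x => (site R C x).comp ((φ x).toAlgHom.comp
    Algebra.TensorProduct.includeLeft)) fun _ _ h _ _ => commute_site R C h _ _

/-- The homomorphism `⨂ B x → ⨂ C x` given at `x` by `b ↦ φ_x (1 ⊗ b)`. -/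
def stackRight : InfTensor R B →ₐ[R] InfTensor R C :=
  liftInf (fun x => (site R C x).comp ((φ x).toAlgHom.comp
    Algebra.TensorProduct.includeRight)) fun _ _ h _ _ => commute_site R C h _ _

theorem stackLeft_site (x : X) (a : A x) :
    stackLeft φ (site R A x a) = site R C x (φ x (a ⊗ₜ 1)) :=
  liftInf_site R A _ _ x a

theorem stackRight_site (x : X) (b : B x) :
    stackRight φ (site R B x b) = site R C x (φ x (1 ⊗ₜ b)) :=
  liftInf_site R B _ _ x b

theorem commute_stack (a : InfTensor R A) (b : InfTensor R B) :
    Commute (stackLeft φ a) (stackRight φ b) := by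
  refine commute_of_commute_site _ _ (fun x y a b => ?_) a b
  rw [stackLeft_site, stackRight_site]
  by_cases h : x = y
  · subst h
    refine Commute.map (f := site R C x) (Commute.map (f := φ x) ?_ )
    simp [Commute, SemiconjBy]
  · exact commute_site R C h _ _

/-- The homomorphism `(⨂ A x) ⊗ (⨂ B x) → ⨂ C x` given pointwise by `φ`. -/
def stackHom : InfTensor R A ⊗[R] InfTensor R B →ₐ[R] InfTensor R C :=
  Algebra.TensorProduct.lift (stackLeft φ) (stackRight φ) (commute_stack φ)

theorem commute_map_site {x y : X} (h : x ≠ y) (t : A x ⊗[R] B x) (s : A y ⊗[R] B y) :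
    Commute (Algebra.TensorProduct.map (site R A x) (site R B x) t)
      (Algebra.TensorProduct.map (site R A y) (site R B y) s) := by
  induction t with
  | zero => simp
  | add t t' ht ht' => rw [map_add]; exact ht.add_left ht'
  | tmul a b =>
    induction s with
    | zero => simp
    | add s s' hs hs' => rw [map_add]; exact hs.add_right hs'
    | tmul a' b' =>
      rw [Algebra.TensorProduct.map_tmul, Algebra.TensorProduct.map_tmul]
      simp only [Commute, SemiconjBy, Algebra.TensorProduct.tmul_mul_tmul]
      rw [(commute_site R A h a a').eq, (commute_site R B h b b').eq]

/-- The inverse of `stackHom`. -/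
def stackInv : InfTensor R C →ₐ[R] InfTensor R A ⊗[R] InfTensor R B :=
  liftInf (fun x => (Algebra.TensorProduct.map (site R A x) (site R B x)).comp
    (φ x).symm.toAlgHom) fun _ _ h _ _ => commute_map_site h _ _

theorem stackInv_site (x : X) (c : C x) : stackInv φ (site R C x c) =
    Algebra.TensorProduct.map (site R A x) (site R B x) ((φ x).symm c) :=
  liftInf_site R C _ _ x c

theorem stackHom_map_site (x : X) (t : A x ⊗[R] B x) :
    stackHom φ (Algebra.TensorProduct.map (site R A x) (site R B x) t) = site R C x (φ x t) := by
  induction t with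
  | zero => simp
  | add t t' ht ht' => simp only [map_add, ht, ht']
  | tmul a b =>
    rw [Algebra.TensorProduct.map_tmul, stackHom, Algebra.TensorProduct.lift_tmul,
      stackLeft_site, stackRight_site, ← map_mul, ← map_mul, Algebra.TensorProduct.tmul_mul_tmul,
      mul_one, one_mul]

theorem stackInv_stackLeft (a : InfTensor R A) : stackInv φ (stackLeft φ a) = a ⊗ₜ 1 := by
  have : (stackInv φ).comp (stackLeft φ) = Algebra.TensorProduct.includeLeft := by
    refine infTensor_ext fun x a => ?_
    rw [AlgHom.comp_apply, stackLeft_site, stackInv_site, AlgEquiv.symm_apply_apply,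
      Algebra.TensorProduct.map_tmul, map_one, Algebra.TensorProduct.includeLeft_apply]
  exact DFunLike.congr_fun this a

theorem stackInv_stackRight (b : InfTensor R B) : stackInv φ (stackRight φ b) = 1 ⊗ₜ b := by
  have : (stackInv φ).comp (stackRight φ) = Algebra.TensorProduct.includeRight := by
    refine infTensor_ext fun x b => ?_
    rw [AlgHom.comp_apply, stackRight_site, stackInv_site, AlgEquiv.symm_apply_apply,
      Algebra.TensorProduct.map_tmul, map_one, Algebra.TensorProduct.includeRight_apply]
  exact DFunLike.congr_fun this b

theorem stackHom_comp_stackInv : (stackHom φ).comp (stackInv φ) = AlgHom.id R _ :=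
  infTensor_ext fun x c => by
    rw [AlgHom.comp_apply, stackInv_site, stackHom_map_site, AlgEquiv.apply_symm_apply,
      AlgHom.id_apply]

theorem stackInv_comp_stackHom : (stackInv φ).comp (stackHom φ) = AlgHom.id R _ :=
  Algebra.TensorProduct.ext' fun a b => by
    rw [AlgHom.comp_apply, stackHom, Algebra.TensorProduct.lift_tmul, map_mul,
      stackInv_stackLeft, stackInv_stackRight, Algebra.TensorProduct.tmul_mul_tmul, mul_one,
      one_mul, AlgHom.id_apply]

/-- The stacking isomorphism `(⨂ A x) ⊗ (⨂ B x) ≃ ⨂ C x` given pointwise by isomorphisms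
`φ_x : A x ⊗ B x ≃ C x`. -/
def stackEquiv : InfTensor R A ⊗[R] InfTensor R B ≃ₐ[R] InfTensor R C :=
  AlgEquiv.ofAlgHom (stackHom φ) (stackInv φ) (stackHom_comp_stackInv φ)
    (stackInv_comp_stackHom φ)

theorem stackLeft_mem {Y : Set X} {a : InfTensor R A} (ha : a ∈ supportedOn R A Y) :
    stackLeft φ a ∈ supportedOn R C Y := by
  have : supportedOn R A Y ≤ (supportedOn R C Y).comap (stackLeft φ) := by
    refine supportedOn_le R A fun x hx => ?_
    rintro _ ⟨a, rfl⟩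
    rw [Subalgebra.mem_comap]
    exact range_site_le R C hx ⟨φ x (a ⊗ₜ 1), (stackLeft_site φ x a).symm⟩
  exact this ha

theorem stackRight_mem {Y : Set X} {b : InfTensor R B} (hb : b ∈ supportedOn R B Y) :
    stackRight φ b ∈ supportedOn R C Y := by
  have : supportedOn R B Y ≤ (supportedOn R C Y).comap (stackRight φ) := by
    refine supportedOn_le R B fun x hx => ?_
    rintro _ ⟨a, rfl⟩
    rw [Subalgebra.mem_comap]
    exact range_site_le R C hx ⟨φ x (1 ⊗ₜ a), (stackRight_site φ x a).symm⟩
  exact this hb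

end Stacking

/-! ### Finite spread -/

section Spread

variable {R : Type u} [CommRing R] {X : Type v} [MetricSpace X] {A B C : X → Type w}
  [∀ x, Ring (A x)] [∀ x, Algebra R (A x)] [∀ x, Ring (B x)] [∀ x, Algebra R (B x)]
  [∀ x, Ring (C x)] [∀ x, Algebra R (C x)]

/-- A homomorphism `α` has finite spread if for some `l > 0` and all `x`, it sends elements
supported at `x` to elements supported on the closed ball of radius `l` around `x`. -/
def FiniteSpread (α : InfTensor R A →ₐ[R] InfTensor R B) : Prop :=
  ∃ l : ℝ, 0 < l ∧ ∀ (x : X) (a : A x),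
    α (site R A x a) ∈ supportedOn R B (Metric.closedBall x l)

theorem finiteSpread_id : FiniteSpread (AlgHom.id R (InfTensor R A)) :=
  ⟨1, one_pos, fun x a => range_site_le R A (by simp) ⟨a, rfl⟩⟩

theorem FiniteSpread.comp {β : InfTensor R B →ₐ[R] InfTensor R C}
    {α : InfTensor R A →ₐ[R] InfTensor R B} (hβ : FiniteSpread β) (hα : FiniteSpread α) :
    FiniteSpread (β.comp α) := by
  obtain ⟨l, hl, h⟩ := hα
  obtain ⟨m, hm, h'⟩ := hβ
  refine ⟨l + m, by positivity, fun x a => ?_⟩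
  have : supportedOn R B (Metric.closedBall x l) ≤
      (supportedOn R C (Metric.closedBall x (l + m))).comap β := by
    refine supportedOn_le R B fun y hy => ?_
    rintro _ ⟨b, rfl⟩
    rw [Subalgebra.mem_comap]
    refine supportedOn_mono R C (Metric.closedBall_subset_closedBall' ?_) (h' y b)
    rw [Metric.mem_closedBall] at hy
    linarith
  exact this (h x a)

theorem FiniteSpread.stack {A' B' C' : X → Type w}
    [∀ x, Ring (A' x)] [∀ x, Algebra R (A' x)] [∀ x, Ring (B' x)] [∀ x, Algebra R (B' x)]
    [∀ x, Ring (C' x)] [∀ x, Algebra R (C' x)]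
    (φ : ∀ x, A x ⊗[R] B x ≃ₐ[R] C x) (φ' : ∀ x, A' x ⊗[R] B' x ≃ₐ[R] C' x)
    {α : InfTensor R A →ₐ[R] InfTensor R A'} {β : InfTensor R B →ₐ[R] InfTensor R B'}
    (hα : FiniteSpread α) (hβ : FiniteSpread β) :
    FiniteSpread (((stackEquiv φ').toAlgHom.comp
      (Algebra.TensorProduct.map α β)).comp (stackEquiv φ).symm.toAlgHom) := by
  obtain ⟨l, hl, h⟩ := hα
  obtain ⟨m, hm, h'⟩ := hβ
  refine ⟨max l m, lt_max_of_lt_left hl, fun x c => ?_⟩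
  change stackHom φ' (Algebra.TensorProduct.map α β (stackInv φ (site R C x c))) ∈ _
  rw [stackInv_site]
  induction (φ x).symm c with
  | zero => simp
  | add t s ht hs => simp only [map_add]; exact Subalgebra.add_mem _ ht hs
  | tmul a b =>
    rw [Algebra.TensorProduct.map_tmul, Algebra.TensorProduct.map_tmul, stackHom,
      Algebra.TensorProduct.lift_tmul]
    refine Subalgebra.mul_mem _ (stackLeft_mem φ' ?_) (stackRight_mem φ' ?_)
    · exact supportedOn_mono R A' (Metric.closedBall_subset_closedBall (le_max_left l m)) (h x a)
    · exact supportedOn_mono R B' (Metric.closedBall_subset_closedBall (le_max_right l m)) (h' x b)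

end Spread

/-! ### Quantum spin systems -/

/-- A quantum spin system over `R` on the metric space `X`: a function `q : X → ℕ_{>0}` such that
every bounded subset of `X` contains only finitely many points `x` with `q x > 1`. -/
@[ext]
structure SpinSystem (R : Type u) (X : Type v) [CommRing R] [MetricSpace X] where
  /-- The dimension function. -/
  dim : X → ℕ+
  /-- Local finiteness. -/
  locallyFinite : ∀ Y : Set X, Bornology.IsBounded Y → (Y ∩ {x | 1 < dim x}).Finite

variable {R : Type u} {X : Type v} [CommRing R] [MetricSpace X]

section Category

open CategoryTheory

namespace SpinSystem

/-- The matrix algebra `Mat(R^{q_x})` at `x`. -/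
abbrev siteAlgebra (q : SpinSystem R X) (x : X) : Type u :=
  Matrix (Fin (q.dim x)) (Fin (q.dim x)) R

/-- The algebra of local observables `⨂_{x ∈ X} Mat(R^{q_x})`. -/
abbrev observables (q : SpinSystem R X) : Type (max u v) := InfTensor R q.siteAlgebra

instance : One (SpinSystem R X) := ⟨⟨fun _ => 1, fun Y _ => by simp⟩⟩

/-- Stacking: the pointwise product of the dimension functions. -/
instance : Mul (SpinSystem R X) :=
  ⟨fun q r => ⟨fun x => q.dim x * r.dim x, fun Y hY => by
    refine ((q.locallyFinite Y hY).union (r.locallyFinite Y hY)).subset ?_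
    rintro x ⟨hx, h⟩
    by_contra hn
    simp only [Set.mem_union, Set.mem_inter_iff, hx, Set.mem_ofPred_eq, true_and, not_or, not_lt,
      le_one_iff_eq_one] at hn
    simp [hn.1, hn.2] at h⟩⟩

theorem mul_dim (q r : SpinSystem R X) (x : X) : (q * r).dim x = q.dim x * r.dim x := rfl

instance : CommMonoid (SpinSystem R X) where
  mul_assoc _ _ _ := SpinSystem.ext (funext fun _ => mul_assoc _ _ _)
  one_mul _ := SpinSystem.ext (funext fun _ => one_mul _)
  mul_one _ := SpinSystem.ext (funext fun _ => mul_one _)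
  mul_comm _ _ := SpinSystem.ext (funext fun _ => mul_comm _ _)

/-- The Kronecker product isomorphism `Mat(R^m) ⊗ Mat(R^n) ≃ Mat(R^{mn})`. -/
def kronecker (m n : ℕ) : Matrix (Fin m) (Fin m) R ⊗[R] Matrix (Fin n) (Fin n) R ≃ₐ[R]
    Matrix (Fin (m * n)) (Fin (m * n)) R :=
  ((Matrix.kroneckerTMulAlgEquiv (Fin m) (Fin n) R R R R).trans
    (Algebra.TensorProduct.lid R R).mapMatrix).trans
      (Matrix.reindexAlgEquiv R R finProdFinEquiv)

/-- The pointwise Kronecker product `Mat(R^{q_x}) ⊗ Mat(R^{r_x}) ≃ Mat(R^{q_x r_x})`. -/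
def kroneckerSite (q r : SpinSystem R X) (x : X) :
    q.siteAlgebra x ⊗[R] r.siteAlgebra x ≃ₐ[R] (q * r).siteAlgebra x :=
  kronecker (q.dim x) (r.dim x)

/-- The stacking isomorphism `𝒜(X, q) ⊗ 𝒜(X, r) ≃ 𝒜(X, q r)`. -/
def stack (q r : SpinSystem R X) :
    q.observables ⊗[R] r.observables ≃ₐ[R] (q * r).observables :=
  stackEquiv (kroneckerSite q r)

/-- A locality-preserving isomorphism between the algebras of observables of two spin systems:
an `R`-algebra isomorphism of finite spread. -/
@[ext]
structure LocalIso (q r : SpinSystem R X) where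
  /-- The underlying isomorphism of algebras. -/
  toAlgEquiv : q.observables ≃ₐ[R] r.observables
  /-- The isomorphism has finite spread. -/
  finiteSpread : FiniteSpread toAlgEquiv.toAlgHom

/-- The category of quantum spin systems and locality-preserving isomorphisms. -/
instance : Category.{max u v} (SpinSystem R X) where
  Hom := LocalIso
  id _ := ⟨AlgEquiv.refl, finiteSpread_id⟩
  comp α β := ⟨α.toAlgEquiv.trans β.toAlgEquiv, β.finiteSpread.comp α.finiteSpread⟩
  id_comp _ := rfl
  comp_id _ := rfl
  assoc _ _ _ := rfl

/-- The stacking `Φ ∘ (α ⊗ β) ∘ Φ⁻¹` of two locality-preserving isomorphisms. -/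
def LocalIso.stack {q r q' r' : SpinSystem R X} (α : LocalIso q q') (β : LocalIso r r') :
    LocalIso (q * r) (q' * r') where
  toAlgEquiv := ((SpinSystem.stack q r).symm.trans
    (Algebra.TensorProduct.congr α.toAlgEquiv β.toAlgEquiv)).trans (SpinSystem.stack q' r')
  finiteSpread := α.finiteSpread.stack (kroneckerSite q r) (kroneckerSite q' r') β.finiteSpread

theorem LocalIso.stack_comp_eq_id {q r q' r' : SpinSystem R X} (α : q ⟶ q') (α' : q' ⟶ q)
    (β : r ⟶ r') (β' : r' ⟶ r) (hα : α ≫ α' = 𝟙 q) (hβ : β ≫ β' = 𝟙 r) :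
    (LocalIso.stack α β : q * r ⟶ q' * r') ≫ (LocalIso.stack α' β' : q' * r' ⟶ q * r) =
      𝟙 (q * r) := by
  have h1 : ∀ a, α'.toAlgEquiv (α.toAlgEquiv a) = a := fun a =>
    DFunLike.congr_fun (congrArg LocalIso.toAlgEquiv hα) a
  have h2 : ∀ b, β'.toAlgEquiv (β.toAlgEquiv b) = b := fun b =>
    DFunLike.congr_fun (congrArg LocalIso.toAlgEquiv hβ) b
  have h3 : ∀ t, Algebra.TensorProduct.congr α'.toAlgEquiv β'.toAlgEquiv
      (Algebra.TensorProduct.congr α.toAlgEquiv β.toAlgEquiv t) = t := by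
    intro t
    induction t with
    | zero => simp only [map_zero]
    | add t s ht hs => simp only [map_add, ht, hs]
    | tmul a b =>
      rw [Algebra.TensorProduct.congr_apply, Algebra.TensorProduct.congr_apply,
        Algebra.TensorProduct.map_tmul, Algebra.TensorProduct.map_tmul]
      exact congrArg₂ _ (h1 a) (h2 b)
  apply LocalIso.ext
  refine AlgEquiv.ext fun a => ?_
  change SpinSystem.stack q r (Algebra.TensorProduct.congr α'.toAlgEquiv β'.toAlgEquiv
    ((SpinSystem.stack q' r').symm (SpinSystem.stack q' r'
      (Algebra.TensorProduct.congr α.toAlgEquiv β.toAlgEquiv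
        ((SpinSystem.stack q r).symm a))))) = a
  rw [AlgEquiv.symm_apply_apply, h3, AlgEquiv.apply_symm_apply]

/-- The stacking of two isomorphisms of spin systems. -/
def stackIso {q r q' r' : SpinSystem R X} (e : q ≅ q') (f : r ≅ r') : q * r ≅ q' * r' where
  hom := LocalIso.stack e.hom f.hom
  inv := LocalIso.stack e.inv f.inv
  hom_inv_id := LocalIso.stack_comp_eq_id _ _ _ _ e.hom_inv_id f.hom_inv_id
  inv_hom_id := LocalIso.stack_comp_eq_id _ _ _ _ e.inv_hom_id f.inv_hom_id

/-- Isomorphism in the category of spin systems, as a congruence for stacking. (The inverse of a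
locality-preserving isomorphism has finite spread, so any morphism is an isomorphism.) -/
def isoCon (R : Type u) (X : Type v) [CommRing R] [MetricSpace X] : Con (SpinSystem R X) where
  toSetoid := isIsomorphicSetoid (SpinSystem R X)
  mul' := by
    rintro q q' r r' ⟨e⟩ ⟨f⟩
    exact ⟨stackIso e f⟩

end SpinSystem

end Category

/-- The commutative monoid of isomorphism classes of spin systems under stacking. -/
abbrev IsoClasses (R : Type u) (X : Type v) [CommRing R] [MetricSpace X] : Type v :=
  (SpinSystem.isoCon R X).Quotient

/-- `K₀` of the category of spin systems: the group completion of the commutative monoid of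
isomorphism classes of spin systems. -/
abbrev K₀ (R : Type u) (X : Type v) [CommRing R] [MetricSpace X] : Type v :=
  Algebra.GrothendieckGroup (IsoClasses R X)


/-! ### Coarse homology -/

section Coarse

variable (X : Type v) [MetricSpace X] (A : Type w) [AddCommGroup A]

/-- Coarse `0`-chains: formal sums `∑ c x [x]` whose terms are locally finite, i.e. every bounded
set contains only finitely many `x` with `c x ≠ 0`. -/
def CC₀ : AddSubgroup (X → A) where
  carrier := {c | ∀ Y : Set X, Bornology.IsBounded Y → {x | x ∈ Y ∧ c x ≠ 0}.Finite}
  zero_mem' := fun Y _ => by simp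
  add_mem' := fun {a b} ha hb Y hY => by
    refine ((ha Y hY).union (hb Y hY)).subset ?_
    rintro x ⟨hx, h⟩
    by_contra hn
    simp only [Set.mem_union, Set.mem_ofPred_eq, hx, true_and, not_or, not_not] at hn
    exact h (by rw [Pi.add_apply, hn.1, hn.2, add_zero])
  neg_mem' := fun {a} ha Y hY => by
    refine (ha Y hY).subset ?_
    rintro x ⟨hx, h⟩
    exact ⟨hx, fun h0 => h (by rw [Pi.neg_apply, h0, neg_zero])⟩

/-- Coarse `1`-chains: formal sums `∑ c (x₀, x₁) [x₀, x₁]` whose terms are locally finite (every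
bounded set contains a component of only finitely many terms; if bounded sets are finite this means
that every point is a component of only finitely many terms) and contained in the
`l`-neighbourhood of the diagonal of `X × X` for some `l > 0`.
The metric on `X × X` is the maximum metric. -/
def CC₁ : AddSubgroup (X × X → A) where
  carrier := {c |
    (∀ Y : Set X, Bornology.IsBounded Y → {p | (p.1 ∈ Y ∨ p.2 ∈ Y) ∧ c p ≠ 0}.Finite) ∧
    ∃ l : ℝ, 0 < l ∧ ∀ p, c p ≠ 0 → p ∈ Metric.thickening l (Set.diagonal X)}
  zero_mem' := ⟨fun Y _ => by simp, 1, one_pos, fun p h => absurd rfl h⟩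
  add_mem' := fun {a b} ha hb => by
    have key : ∀ p, (a + b) p ≠ 0 → a p ≠ 0 ∨ b p ≠ 0 := by
      intro p h
      by_contra! hn
      exact h (by rw [Pi.add_apply, hn.1, hn.2, add_zero])
    obtain ⟨ha, l, hl, hal⟩ := ha
    obtain ⟨hb, m, hm, hbm⟩ := hb
    refine ⟨fun Y hY => ((ha Y hY).union (hb Y hY)).subset ?_, max l m, lt_max_of_lt_left hl, ?_⟩
    · rintro p ⟨hp, h⟩
      exact (key p h).imp (fun h' => ⟨hp, h'⟩) fun h' => ⟨hp, h'⟩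
    · intro p h
      exact (key p h).elim
        (fun h' => Metric.thickening_mono (le_max_left l m) _ (hal p h'))
        fun h' => Metric.thickening_mono (le_max_right l m) _ (hbm p h')
  neg_mem' := fun {a} ha => by
    have key : ∀ p, (-a) p ≠ 0 → a p ≠ 0 := fun p h h0 => h (by rw [Pi.neg_apply, h0, neg_zero])
    obtain ⟨ha, l, hl, hal⟩ := ha
    exact ⟨fun Y hY => (ha Y hY).subset fun p hp => ⟨hp.1, key p hp.2⟩, l, hl,
      fun p h => hal p (key p h)⟩

variable {X A}

theorem CC₁.finite_fst (c : CC₁ X A) (x : X) :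
    (Function.support fun y => c.1 (x, y)).Finite := by
  refine Set.Finite.of_finite_image ((c.2.1 {x} Bornology.isBounded_singleton).subset ?_)
    (f := fun y => (x, y)) fun y _ z _ h => (Prod.ext_iff.1 h).2
  rintro _ ⟨y, hy, rfl⟩
  exact ⟨Or.inl rfl, hy⟩

theorem CC₁.finite_snd (c : CC₁ X A) (x : X) :
    (Function.support fun y => c.1 (y, x)).Finite := by
  refine Set.Finite.of_finite_image ((c.2.1 {x} Bornology.isBounded_singleton).subset ?_)
    (f := fun y => (y, x)) fun y _ z _ h => (Prod.ext_iff.1 h).1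
  rintro _ ⟨y, hy, rfl⟩
  exact ⟨Or.inr rfl, hy⟩

variable (X A)

/-- The boundary homomorphism, the locally finite extension of `∂ [x₀, x₁] = [x₁] - [x₀]`: the
coefficient of `∂ c` at `x` is the sum of the coefficients of the terms `[y, x]` minus the sum of
the coefficients of the terms `[x, y]`; both sums have only finitely many nonzero terms. -/
def boundary : CC₁ X A →+ CC₀ X A where
  toFun c := ⟨fun x => ∑ᶠ y, c.1 (y, x) - ∑ᶠ y, c.1 (x, y), fun Y hY => by
    refine (((c.2.1 Y hY).image Prod.fst).union ((c.2.1 Y hY).image Prod.snd)).subset ?_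
    rintro x ⟨hx, h⟩
    by_contra hn
    simp only [Set.mem_union, Set.mem_image, not_or, not_exists, not_and] at hn
    refine h ?_
    have h1 : ∀ y, c.1 (y, x) = 0 := fun y => by
      by_contra h0
      exact hn.2 (y, x) ⟨Or.inr hx, h0⟩ rfl
    have h2 : ∀ y, c.1 (x, y) = 0 := fun y => by
      by_contra h0
      exact hn.1 (x, y) ⟨Or.inl hx, h0⟩ rfl
    simp only [h1, h2, finsum_zero, sub_zero]⟩
  map_zero' := by
    apply Subtype.ext
    funext x
    simp
  map_add' c d := by
    apply Subtype.ext
    funext x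
    have h1 := finsum_add_distrib (CC₁.finite_snd c x) (CC₁.finite_snd d x)
    have h2 := finsum_add_distrib (CC₁.finite_fst c x) (CC₁.finite_fst d x)
    simp only [AddSubgroup.coe_add, Pi.add_apply, h1, h2]
    abel

/-- The `0`-th coarse homology group `CH₀(X, A) = CC₀(X, A) / im ∂`. -/
abbrev CH₀ : Type (max v w) := CC₀ X A ⧸ (boundary X A).range

end Coarse

end QuantumSpin

end

/-! To a spin system `q` attach the locally finite `0`-chain whose coefficient at `x` is the vector
of prime exponents of `q.dim x`. Stacking becomes addition of chains, so the proof must show that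
this gives a well-defined map on isomorphism classes and that it becomes bijective after group
completion.

Well-defined: let `α` have spread `l`. The factors over a finite set `Γ` form a matrix algebra of
size `∏ q`, which `α` sends into the matrix algebra on the finitely many nontrivial sites within `l`
of `Γ`. A unital homomorphism between matrix algebras over a nonzero ring forces divisibility of
sizes (`dvd_of_algHom`), so `∏ q` over `Γ` divides `∏ r` over a finite set near `Γ`. For a fixed
prime, regard the exponent at `x` as a number of particles at `x`. Divisibility is then Hall's
condition, and it holds in both directions. Hall's theorem and a Schröder–Bernstein argument give a
bijection of particles moving each by a bounded distance (`exists_transport`). The bound is the same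
for all primes, so counting the particles moved from `x` to `y` gives a coarse `1`-chain with
boundary `r - q` (`SpinSystem.logChain_sub_mem_of_dvd`).

Surjective: a chain of integer vectors is the difference of its positive and negative parts, and
each part is the chain of a spin system (`SpinSystem.exists_logChain_sub_eq`).

Injective: suppose `q - r = ∂c`. Place a matrix algebra at one end of each edge in the support of
`c`. Sliding all of them to the other end is a locality-preserving isomorphism `s ≅ t`, because
edges have bounded length, and it changes the chain by `∂c`. Hence `q * s = r * t` on the nose
(`SpinSystem.exists_mul_eq_mul`), and the classes of `q` and `r` agree once cancellation is allowed.
-/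

noncomputable section

namespace QuantumSpin

/-! ### Finite tensor products of matrix algebras -/

section PiKronecker

variable (R : Type u) [CommRing R] {ι : Type v} [Fintype ι] (κ : ι → Type*)

/-- The Kronecker product of a finite family of matrices, as a multilinear map. -/
def piKroneckerMultilinear :
    MultilinearMap R (fun i => Matrix (κ i) (κ i) R) (Matrix (∀ i, κ i) (∀ i, κ i) R) where
  toFun a := Matrix.of fun p q => ∏ i, a i (p i) (q i)
  map_update_add' a i b c := by
    ext p q
    simp only [Matrix.of_apply, Matrix.add_apply]
    rw [← Finset.mul_prod_erase _ _ (Finset.mem_univ i), ← Finset.mul_prod_erase _ _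
      (Finset.mem_univ i), ← Finset.mul_prod_erase _ _ (Finset.mem_univ i)]
    simp only [Function.update_self, Matrix.add_apply, add_mul]
    congr 2 <;> exact Finset.prod_congr rfl fun j hj => by
      rw [Function.update_of_ne (Finset.ne_of_mem_erase hj),
        Function.update_of_ne (Finset.ne_of_mem_erase hj)]
  map_update_smul' a i c b := by
    ext p q
    simp only [Matrix.of_apply, Matrix.smul_apply]
    rw [← Finset.mul_prod_erase _ _ (Finset.mem_univ i), ← Finset.mul_prod_erase _ _
      (Finset.mem_univ i)]
    simp only [Function.update_self, Matrix.smul_apply, smul_eq_mul, mul_assoc]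
    congr 2
    exact Finset.prod_congr rfl fun j hj => by
      rw [Function.update_of_ne (Finset.ne_of_mem_erase hj),
        Function.update_of_ne (Finset.ne_of_mem_erase hj)]

theorem piKroneckerMultilinear_apply (a : ∀ i, Matrix (κ i) (κ i) R) (p q : ∀ i, κ i) :
    piKroneckerMultilinear R κ a p q = ∏ i, a i (p i) (q i) := rfl

variable [∀ i, Fintype (κ i)] [∀ i, DecidableEq (κ i)] [DecidableEq ι]

/-- The Kronecker product homomorphism `⨂ᵢ Mat(R^{κ i}) → Mat(R^{∏ κ i})`. -/
def piKroneckerHom :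
    (⨂[R] i, Matrix (κ i) (κ i) R) →ₐ[R] Matrix (∀ i, κ i) (∀ i, κ i) R :=
  PiTensorProduct.liftAlgHom (piKroneckerMultilinear R κ)
    (by
      ext p q
      rw [piKroneckerMultilinear_apply]
      simp only [Pi.one_apply, Matrix.one_apply, Fintype.prod_ite_zero, Finset.prod_const_one,
        funext_iff])
    (fun a b => by
      ext p q
      simp only [piKroneckerMultilinear_apply, Matrix.mul_apply, Pi.mul_apply,
        ← Finset.prod_mul_distrib]
      rw [Finset.prod_univ_sum, Fintype.piFinset_univ])

/-- An elementary tensor of matrix units is a matrix unit, so the map carries one standard basis to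
the other. The index sets match through `e`, which turns a pair of functions into a function to
pairs. -/
theorem piKroneckerHom_bijective : Function.Bijective (piKroneckerHom R κ) := by
  let e : (∀ i, κ i) × (∀ i, κ i) ≃ ∀ i, κ i × κ i :=
    { toFun := fun p i => (p.1 i, p.2 i)
      invFun := fun p => (fun i => (p i).1, fun i => (p i).2)
      left_inv := fun _ => rfl
      right_inv := fun _ => rfl }
  let b := Basis.piTensorProduct fun i => Matrix.stdBasis R (κ i) (κ i)
  let b' := (Matrix.stdBasis R (∀ i, κ i) (∀ i, κ i)).reindex e
  have h : (piKroneckerHom R κ).toLinearMap = (b.equiv b' (Equiv.refl _)).toLinearMap := by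
    refine b.ext fun p => ?_
    rw [LinearEquiv.coe_coe, Module.Basis.equiv_apply, Basis.piTensorProduct_apply,
      AlgHom.toLinearMap_apply, piKroneckerHom, PiTensorProduct.liftAlgHom_apply,
      PiTensorProduct.lift.tprod, Equiv.refl_apply, Module.Basis.reindex_apply]
    ext i j
    have : e.symm p = (fun i => (p i).1, fun i => (p i).2) := rfl
    have h' (x) : Matrix.stdBasis R (κ x) (κ x) (p x) = Matrix.single (p x).1 (p x).2 1 :=
      Matrix.stdBasis_eq_single R (p x).1 (p x).2
    rw [piKroneckerMultilinear_apply, this, Matrix.stdBasis_eq_single]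
    simp only [h', Matrix.single_apply, Fintype.prod_ite_zero,
      Finset.prod_const_one, funext_iff, forall_and]
  have h2 : (piKroneckerHom R κ : _ → _) = b.equiv b' (Equiv.refl _) :=
    funext fun x => LinearMap.congr_fun h x
  rw [h2]
  exact LinearEquiv.bijective _

/-- The Kronecker product isomorphism `⨂ᵢ Mat(R^{nᵢ}) ≃ Mat(R^m)` for `m = ∏ᵢ nᵢ`. -/
def piKronecker (n : ι → ℕ) (m : ℕ) (h : ∏ i, n i = m) :
    (⨂[R] i, Matrix (Fin (n i)) (Fin (n i)) R) ≃ₐ[R] Matrix (Fin m) (Fin m) R :=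
  (AlgEquiv.ofBijective (piKroneckerHom R fun i => Fin (n i)) (piKroneckerHom_bijective R _)).trans
    (Matrix.reindexAlgEquiv R R (Fintype.equivFinOfCardEq (by simp [h])))

end PiKronecker

/-! ### Homomorphisms from matrix algebras -/

/-- Every entry of `M` is recovered, as a scalar matrix, from `M` by multiplying with matrix units:
`M i j • 1 = ∑ a, E_ai M E_ja`. If `f M = 0`, all entries therefore die in `S`, where scalars embed.
-/
theorem injective_of_matrix {R : Type u} [CommRing R] {n : Type*} [Fintype n] [DecidableEq n]
    {S : Type*} [Ring S] [Algebra R S] (hS : Function.Injective (algebraMap R S))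
    (f : Matrix n n R →ₐ[R] S) : Function.Injective f := by
  rw [injective_iff_map_eq_zero]
  intro M hM
  ext i j
  refine hS ?_
  have h1 : algebraMap R (Matrix n n R) (M i j) =
      ∑ a, Matrix.single a i (1 : R) * M * Matrix.single j a (1 : R) := by
    ext p q
    simp [Matrix.algebraMap_matrix_apply, Matrix.sum_apply, Matrix.single_mul_mul_single,
      Matrix.single_apply, ite_and]
  rw [← f.commutes, h1]
  simp only [map_sum, map_mul, hM, mul_zero, zero_mul, Finset.sum_const_zero, Matrix.zero_apply,
    map_zero]

/-- The images of the matrix units act on `k^m`. The diagonal ones are complementary projections,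
and the off-diagonal ones identify their ranges with one another. So `k^m` is a sum of `n` copies of
one space `W`, and `m = n * dim W`. -/
theorem dvd_of_ringHom_field {R : Type u} [CommRing R] {k : Type*} [Field k] {n m : ℕ} (hn : 0 < n)
    (f : Matrix (Fin n) (Fin n) R →+* Matrix (Fin m) (Fin m) k) : n ∣ m := by
  let ψ (a b : Fin n) : (Fin m → k) →ₗ[k] (Fin m → k) :=
    Matrix.toLin' (f (Matrix.single a b 1))
  have hψ (a b c : Fin n) (v) : ψ a b (ψ b c v) = ψ a c v := by
    simp only [ψ, ← Matrix.toLin'_mul_apply, ← map_mul, Matrix.single_mul_single_same, one_mul]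
  have hψ' (a b b' c : Fin n) (h : b ≠ b') (v) : ψ a b (ψ b' c v) = 0 := by
    simp only [ψ, ← Matrix.toLin'_mul_apply, ← map_mul, Matrix.single_mul_single_of_ne _ _ _ _ h,
      map_zero, LinearMap.zero_apply]
  have hsum (v) : ∑ a, ψ a a v = v := by
    simp only [ψ]
    rw [← LinearMap.sum_apply, ← map_sum, ← map_sum]
    have : ∑ a : Fin n, Matrix.single a a (1 : R) = 1 := by
      ext i j
      simp [Matrix.sum_apply, Matrix.single_apply, Matrix.one_apply, ite_and]
    rw [this, map_one, Matrix.toLin'_one, LinearMap.id_apply]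
  let o : Fin n := ⟨0, hn⟩
  let W := LinearMap.range (ψ o o)
  let e : (Fin m → k) ≃ₗ[k] (Fin n → W) :=
    { toFun := fun v a => ⟨ψ o a v, ψ o a v, hψ o o a v⟩
      map_add' := fun v w => by ext; simp
      map_smul' := fun c v => by ext; simp
      invFun := fun w => ∑ a, ψ a o (w a)
      left_inv := fun v => by simp only [hψ]; exact hsum v
      right_inv := fun w => by
        funext a
        obtain ⟨v, hv⟩ := (w a).2
        refine Subtype.ext ?_
        change ψ o a (∑ b, ψ b o (w b)) = w a
        rw [map_sum, Finset.sum_eq_single a (fun b _ hb => hψ' _ _ _ _ hb.symm _)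
          (fun h => absurd (Finset.mem_univ a) h), hψ, ← hv, hψ] }
  have := e.finrank_eq
  rw [Module.finrank_fin_fun, Module.finrank_pi_fintype, Finset.sum_const, Finset.card_univ,
    Fintype.card_fin, smul_eq_mul] at this
  exact ⟨_, this⟩

/-- Reducing the target modulo a maximal ideal of `R` brings the question to a field. -/
theorem dvd_of_algHom {R : Type u} [CommRing R] [Nontrivial R] {n m : ℕ} (hn : 0 < n)
    (f : Matrix (Fin n) (Fin n) R →ₐ[R] Matrix (Fin m) (Fin m) R) : n ∣ m := by
  obtain ⟨I, hI⟩ := Ideal.exists_maximal R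
  let := Ideal.Quotient.field I
  exact dvd_of_ringHom_field hn (((Ideal.Quotient.mk I).mapMatrix).comp f.toRingHom)

/-! ### Infinite tensor products of matrix algebras -/

theorem commute_of_disjoint {R : Type u} [CommRing R] {X : Type v} {A : X → Type w}
    [∀ x, Ring (A x)] [∀ x, Algebra R (A x)] {Y Z : Set X} (h : Disjoint Y Z)
    {a b : InfTensor R A} (ha : a ∈ supportedOn R A Y) (hb : b ∈ supportedOn R A Z) :
    Commute a b := by
  have h1 : ∀ y ∈ Y, ∀ c : A y, Commute (site R A y c) b := fun y hy c => by
    have : supportedOn R A Z ≤ Subalgebra.centralizer R {site R A y c} :=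
      supportedOn_le R A fun z hz => by
        rintro _ ⟨d, rfl⟩
        rw [Subalgebra.mem_centralizer_iff]
        rintro _ rfl
        exact commute_site R A (Set.disjoint_iff_forall_ne.1 h hy hz) c d
    exact (Subalgebra.mem_centralizer_iff R).1 (this hb) _ rfl
  have : supportedOn R A Y ≤ Subalgebra.centralizer R {b} :=
    supportedOn_le R A fun y hy => by
      rintro _ ⟨c, rfl⟩
      rw [Subalgebra.mem_centralizer_iff]
      rintro _ rfl
      exact (h1 y hy c).symm
  exact ((Subalgebra.mem_centralizer_iff R).1 (this ha) _ rfl).symm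

/-! ### Matrix factors at the sites and divisibility of their dimensions -/

section MatrixFamily

variable (R : Type u) [CommRing R] {X : Type v} (D : X → ℕ+)

/-- The family of matrix algebras `Mat(R^{D x})`. -/
abbrev matrixFamily (x : X) : Type u := Matrix (Fin (D x)) (Fin (D x)) R

/-- The Kronecker product isomorphism on finitely many sites. -/
def finKronecker (Γ : Finset X) : FinTensor R (matrixFamily R D) Γ ≃ₐ[R]
    Matrix (Fin (∏ x ∈ Γ, (D x : ℕ))) (Fin (∏ x ∈ Γ, (D x : ℕ))) R :=
  letI := Classical.decEq X
  piKronecker R (fun x : Γ => (D x : ℕ)) _ (Finset.prod_coe_sort Γ fun x => (D x : ℕ))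

theorem prod_dim_pos (Γ : Finset X) : 0 < ∏ x ∈ Γ, (D x : ℕ) :=
  Finset.prod_pos fun x _ => (D x).pos

theorem incl_injective (Γ Γ' : Finset X) (h : Γ ≤ Γ') :
    Function.Injective (incl R (matrixFamily R D) Γ Γ' h) := by
  have hS : Function.Injective (algebraMap R (FinTensor R (matrixFamily R D) Γ')) := by
    intro a b hab
    -- As a matrix the scalar `a` has `a` in its top left entry, which exists because the size is
    -- positive.
    have h1 := congrArg (finKronecker R D Γ') hab
    rw [AlgEquiv.commutes, AlgEquiv.commutes] at h1
    have h2 := congrFun (congrFun h1 ⟨0, prod_dim_pos D Γ'⟩) ⟨0, prod_dim_pos D Γ'⟩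
    simpa [Matrix.algebraMap_matrix_apply] using h2
  have h3 := injective_of_matrix hS
    ((incl R (matrixFamily R D) Γ Γ' h).comp (finKronecker R D Γ).symm.toAlgHom)
  intro a b hab
  apply (finKronecker R D Γ).injective
  apply h3
  change incl R (matrixFamily R D) Γ Γ' h ((finKronecker R D Γ).symm (finKronecker R D Γ a)) =
    incl R (matrixFamily R D) Γ Γ' h ((finKronecker R D Γ).symm (finKronecker R D Γ b))
  rw [AlgEquiv.symm_apply_apply, AlgEquiv.symm_apply_apply, hab]

theorem ofFin_injective (Γ : Finset X) : Function.Injective (ofFin R (matrixFamily R D) Γ) :=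
  DirectLimit.mk_injective _ (incl_injective R D) Γ

-- A `1 × 1` matrix is a scalar, so a site of dimension `1` contributes nothing beyond the base
-- ring.
variable {D} in
theorem range_site_le_of_eq_one {x : X} (h : D x = 1)
    (B : Subalgebra R (InfTensor R (matrixFamily R D))) :
    (site R (matrixFamily R D) x).range ≤ B := by
  rintro _ ⟨a, rfl⟩
  have : Subsingleton (Fin (D x)) := by rw [h]; exact inferInstanceAs (Subsingleton (Fin 1))
  have ha : a = algebraMap R _ (a ⟨0, (D x).pos⟩ ⟨0, (D x).pos⟩) := by
    ext i j
    rw [Subsingleton.elim i ⟨0, (D x).pos⟩, Subsingleton.elim j ⟨0, (D x).pos⟩,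
      Matrix.algebraMap_matrix_apply, if_pos rfl, Algebra.algebraMap_self, RingHom.id_apply]
  change site R (matrixFamily R D) x a ∈ B
  rw [ha, AlgHom.commutes]
  exact B.algebraMap_mem _

-- A possibly infinite region thus carries only a finite matrix algebra as soon as its nontrivial
-- sites are finitely many. For bounded regions, local finiteness ensures this.
variable {D} in
theorem supportedOn_le_range_ofFin {Y : Set X} {Γ : Finset X} (h : ∀ x ∈ Y, D x ≠ 1 → x ∈ Γ) :
    supportedOn R (matrixFamily R D) Y ≤ (ofFin R (matrixFamily R D) Γ).range := by
  refine supportedOn_le R _ fun x hx => ?_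
  by_cases h1 : D x = 1
  · exact range_site_le_of_eq_one R h1 _
  · rintro _ ⟨a, rfl⟩
    exact ⟨factor R _ Γ x (h x hx h1) a, ofFin_factor R _ Γ x _ a⟩

variable {R} in
/-- A homomorphism maps the tensor product over `Γ` into that over `Γ'` only if the dimension of
the former divides that of the latter. -/
theorem prod_dvd_prod [Nontrivial R] {D E : X → ℕ+}
    (α : InfTensor R (matrixFamily R D) →ₐ[R] InfTensor R (matrixFamily R E)) (Γ Γ' : Finset X)
    (h : ∀ x ∈ Γ, ∀ a, α (site R _ x a) ∈ (ofFin R (matrixFamily R E) Γ').range) :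
    ∏ x ∈ Γ, D x ∣ ∏ x ∈ Γ', E x := by
  have h1 : supportedOn R (matrixFamily R D) Γ ≤
      (ofFin R (matrixFamily R E) Γ').range.comap α := by
    refine supportedOn_le R _ fun x hx => ?_
    rintro _ ⟨a, rfl⟩
    exact h x hx a
  have h2 (a) : α (ofFin R _ Γ a) ∈ (ofFin R (matrixFamily R E) Γ').range :=
    h1 ((le_iSup₂_of_le (f := fun (Δ : Finset X) (_ : (Δ : Set X) ⊆ Γ) =>
      (ofFin R (matrixFamily R D) Δ).range) Γ le_rfl le_rfl) ⟨a, rfl⟩)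
  -- The restriction of `α` to `Γ`, read as a map of matrix algebras. Injectivity of `ofFin` allows
  -- its values to be pulled back to the tensor product over `Γ'`.
  let f := (((finKronecker R E Γ').toAlgHom.comp (AlgEquiv.ofInjective _
    (ofFin_injective R E Γ')).symm.toAlgHom).comp ((α.comp (ofFin R _ Γ)).codRestrict _ h2)).comp
      (finKronecker R D Γ).symm.toAlgHom
  rw [PNat.dvd_iff, ← PNat.coe_coeMonoidHom, map_prod, map_prod]
  exact dvd_of_algHom (prod_dim_pos D Γ) f

end MatrixFamily

theorem FiniteSpread.exists_prod_dvd_prod {R : Type u} [CommRing R] [Nontrivial R] {X : Type v}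
    [MetricSpace X] {q r : SpinSystem R X} {α : q.observables →ₐ[R] r.observables}
    (hα : FiniteSpread α) : ∃ l : ℝ, 0 < l ∧ ∀ Γ : Finset X, ∃ Γ' : Finset X,
      (∀ y ∈ Γ', ∃ x ∈ Γ, dist x y ≤ l) ∧ ∏ x ∈ Γ, q.dim x ∣ ∏ x ∈ Γ', r.dim x := by
  obtain ⟨l, hl, h⟩ := hα
  refine ⟨l, hl, fun Γ => ?_⟩
  -- `Γ'` consists of the nontrivial sites of `r` within `l` of `Γ`. The remaining sites of the
  -- balls carry only scalars.
  have hfin : (⋃ x ∈ Γ, Metric.closedBall x l ∩ {y | 1 < r.dim y}).Finite :=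
    Set.Finite.biUnion Γ.finite_toSet fun x _ => r.locallyFinite _ Metric.isBounded_closedBall
  refine ⟨hfin.toFinset, fun y hy => ?_, prod_dvd_prod α _ _ fun x hx a =>
    supportedOn_le_range_ofFin R (fun y hy h1 => ?_) (h x a)⟩
  · rw [Set.Finite.mem_toFinset] at hy
    simp only [Set.mem_iUnion] at hy
    obtain ⟨x, hx, hy, _⟩ := hy
    exact ⟨x, hx, by rwa [dist_comm]⟩
  · rw [Set.Finite.mem_toFinset]
    simp only [Set.mem_iUnion]
    exact ⟨x, hx, hy, lt_of_le_of_ne one_le (Ne.symm h1)⟩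

/-! ### Controlled transport -/

theorem finsum_card_fiber {β X : Type*} [Finite β] (f : β → X) :
    ∑ᶠ x, Nat.card {b // f b = x} = Nat.card β := by
  classical
  have := Fintype.ofFinite β
  rw [finsum_eq_sum_of_support_subset (s := Finset.univ.image f), Nat.card_eq_fintype_card,
    ← Finset.card_univ, Finset.card_eq_sum_card_image f]
  · exact Finset.sum_congr rfl fun x _ => by rw [Nat.card_eq_fintype_card, Fintype.card_subtype]
  · intro x hx
    rw [Function.mem_support, Nat.card_ne_zero] at hx
    obtain ⟨⟨b, rfl⟩⟩ := hx.1
    simp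

section Transport

variable {X : Type*} [PseudoMetricSpace X] {n m : X → ℕ} {l : ℝ}

/-- Hall's theorem for distributions of indistinguishable particles. -/
theorem exists_injective_sigma (hm : ∀ x, {y | dist x y ≤ l ∧ m y ≠ 0}.Finite)
    (h : ∀ Γ : Finset X, ∃ Γ' : Finset X, (∀ y ∈ Γ', ∃ x ∈ Γ, dist x y ≤ l) ∧
      ∑ x ∈ Γ, n x ≤ ∑ y ∈ Γ', m y) :
    ∃ f : (Σ x, Fin (n x)) → Σ y, Fin (m y), Function.Injective f ∧
      ∀ t, dist t.1 (f t).1 ≤ l := by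
  classical
  -- The particles within `l` of `t`. Only sites with `m y ≠ 0` carry particles, which makes this
  -- set finite.
  let N : (Σ x, Fin (n x)) → Finset (Σ y, Fin (m y)) := fun t =>
    (hm t.1).toFinset.sigma fun _ => Finset.univ
  have hN (t : Σ x, Fin (n x)) (s : Σ y, Fin (m y)) : s ∈ N t ↔ dist t.1 s.1 ≤ l := by
    simp only [N, Finset.mem_sigma, Set.Finite.mem_toFinset, Set.mem_ofPred_eq, Finset.mem_univ,
      and_true, and_iff_left_iff_imp]
    intro _ h0
    exact (Fin.cast h0 s.2).elim0
  obtain ⟨f, hf, hf'⟩ := (Finset.all_card_le_biUnion_card_iff_exists_injective N).1 fun s => by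
    obtain ⟨Γ', h1, h2⟩ := h (s.image Sigma.fst)
    -- Admissible targets depend only on the site, so `s` may be enlarged to all particles on its
    -- sites.
    calc s.card ≤ ((s.image Sigma.fst).sigma fun x => (Finset.univ : Finset (Fin (n x)))).card :=
          Finset.card_le_card fun t ht => by
            simpa using ⟨t.2, ht⟩
      _ = ∑ x ∈ s.image Sigma.fst, n x := by simp
      _ ≤ ∑ y ∈ Γ', m y := h2
      _ = (Γ'.sigma fun y => (Finset.univ : Finset (Fin (m y)))).card := by simp
      _ ≤ _ := Finset.card_le_card fun t ht => by
          obtain ⟨x, hx, hxy⟩ := h1 t.1 (Finset.mem_sigma.1 ht).1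
          obtain ⟨u, hu, rfl⟩ := Finset.mem_image.1 hx
          exact Finset.mem_biUnion.2 ⟨u, hu, (hN _ _).2 hxy⟩
  exact ⟨f, hf, fun t => (hN _ _).1 (hf' t)⟩

/-- Hall's theorem gives injections of particles both ways. The Schröder–Bernstein bijection agrees
at each particle with one injection or with the inverse of the other, so it still moves particles by
at most `l`. The value `c x y` counts the particles sent from `x` to `y`. -/
theorem exists_transport (hn : ∀ x, {y | dist x y ≤ l ∧ n y ≠ 0}.Finite)
    (hm : ∀ x, {y | dist x y ≤ l ∧ m y ≠ 0}.Finite)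
    (h : ∀ Γ : Finset X, ∃ Γ' : Finset X, (∀ y ∈ Γ', ∃ x ∈ Γ, dist x y ≤ l) ∧
      ∑ x ∈ Γ, n x ≤ ∑ y ∈ Γ', m y)
    (h' : ∀ Γ : Finset X, ∃ Γ' : Finset X, (∀ y ∈ Γ', ∃ x ∈ Γ, dist x y ≤ l) ∧
      ∑ x ∈ Γ, m x ≤ ∑ y ∈ Γ', n y) :
    ∃ c : X → X → ℕ, (∀ x y, c x y ≠ 0 → dist x y ≤ l) ∧ (∀ x y, c x y ≤ n x) ∧
      (∀ x y, c x y ≤ m y) ∧ (∀ x, ∑ᶠ y, c x y = n x) ∧ ∀ y, ∑ᶠ x, c x y = m y := by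
  obtain ⟨f, hf, hfl⟩ := exists_injective_sigma hm h
  obtain ⟨g, hg, hgl⟩ := exists_injective_sigma hn h'
  obtain ⟨e, he, hel⟩ := Function.Embedding.schroeder_bernstein_of_rel hf hg
    (fun t s => dist t.1 s.1 ≤ l) hfl fun s => by rw [dist_comm]; exact hgl s
  have hx (x) : Nat.card {t : Σ x, Fin (n x) // t.1 = x} = n x := by
    rw [Nat.card_congr (Equiv.sigmaSubtype x), Nat.card_fin]
  have ey (y) : {t : Σ x, Fin (n x) // (e t).1 = y} ≃ Fin (m y) :=
    ((Equiv.ofBijective e he).subtypeEquiv (q := fun s => s.1 = y) fun _ => Iff.rfl).trans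
      (Equiv.sigmaSubtype y)
  have hy (y) : Nat.card {t : Σ x, Fin (n x) // (e t).1 = y} = m y := by
    rw [Nat.card_congr (ey y), Nat.card_fin]
  have hx' (x) : Finite {t : Σ x, Fin (n x) // t.1 = x} :=
    Finite.of_equiv _ (Equiv.sigmaSubtype x).symm
  have hy' (y) : Finite {t : Σ x, Fin (n x) // (e t).1 = y} := Finite.of_equiv _ (ey y).symm
  refine ⟨fun x y => Nat.card {t : Σ x, Fin (n x) // t.1 = x ∧ (e t).1 = y}, fun x y hxy => ?_,
    fun x y => ?_, fun x y => ?_, fun x => ?_, fun y => ?_⟩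
  · obtain ⟨⟨t, rfl, rfl⟩⟩ := (Nat.card_ne_zero.1 hxy).1
    exact hel t
  · rw [← hx x]
    exact Nat.card_le_card_of_injective (Subtype.impEmbedding _ _ fun t ht => ht.1)
      (Function.Embedding.injective _)
  · rw [← hy y]
    exact Nat.card_le_card_of_injective (Subtype.impEmbedding _ _ fun t ht => ht.2)
      (Function.Embedding.injective _)
  · rw [← hx x, ← finsum_card_fiber fun t : {t : Σ x, Fin (n x) // t.1 = x} => (e t).1]
    exact finsum_congr fun y => Nat.card_congr
      (Equiv.subtypeSubtypeEquivSubtypeInter (fun t : Σ x, Fin (n x) => t.1 = x)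
        fun t => (e t).1 = y).symm
  · rw [← hy y, ← finsum_card_fiber fun t : {t : Σ x, Fin (n x) // (e t).1 = y} => t.1.1]
    exact finsum_congr fun x => Nat.card_congr
      ((Equiv.subtypeSubtypeEquivSubtypeInter (fun t : Σ x, Fin (n x) => (e t).1 = y)
        fun t => t.1 = x).trans (Equiv.subtypeEquivRight fun t => and_comm)).symm

end Transport

/-! ### Prime exponents -/

/-- The vector of exponents of a positive integer at the primes, listed in some order. -/
def exponents : Additive ℕ+ ≃+ (ℕ →₀ ℕ) :=
  (AddEquiv.mk' (Additive.toMul.trans PNat.factorMultisetEquiv)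
    fun a b => PNat.factorMultiset_mul a.toMul b.toMul : Additive ℕ+ ≃+ PrimeMultiset).trans <|
  (AddEquiv.mk' (Equiv.refl (Multiset Nat.Primes)) fun _ _ => rfl :
    PrimeMultiset ≃+ Multiset Nat.Primes).trans <|
  Multiset.toFinsupp.trans <| Finsupp.domCongr <|
    Classical.choice (nonempty_equiv_of_countable (α := Nat.Primes) (β := ℕ))

/-- The vector of prime exponents of a positive integer. -/
def logDim (n : ℕ+) : ℕ →₀ ℕ := exponents (Additive.ofMul n)

/-- The positive integer with given vector of prime exponents. -/
def expDim (e : ℕ →₀ ℕ) : ℕ+ := (exponents.symm e).toMul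

@[simp]
theorem logDim_expDim (e : ℕ →₀ ℕ) : logDim (expDim e) = e := exponents.apply_symm_apply e

@[simp]
theorem expDim_logDim (n : ℕ+) : expDim (logDim n) = n :=
  congrArg Additive.toMul (exponents.symm_apply_apply (Additive.ofMul n))

@[simp]
theorem logDim_one : logDim 1 = 0 := map_zero exponents

@[simp]
theorem logDim_mul (m n : ℕ+) : logDim (m * n) = logDim m + logDim n :=
  map_add exponents (Additive.ofMul m) (Additive.ofMul n)

theorem logDim_injective : Function.Injective logDim := fun m n h => by
  rw [← expDim_logDim m, h, expDim_logDim]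

@[simp]
theorem logDim_eq_zero {n : ℕ+} : logDim n = 0 ↔ n = 1 := by
  rw [← logDim_one, logDim_injective.eq_iff]

theorem one_lt_of_logDim_ne_zero {n : ℕ+} (h : logDim n ≠ 0) : 1 < n :=
  lt_of_le_of_ne one_le fun h1 => h (logDim_eq_zero.2 h1.symm)

theorem logDim_prod {X : Type*} (s : Finset X) (D : X → ℕ+) :
    logDim (∏ x ∈ s, D x) = ∑ x ∈ s, logDim (D x) := by
  classical
  induction s using Finset.induction_on with
  | empty => simp
  | insert x s hx ih => rw [Finset.prod_insert hx, Finset.sum_insert hx, logDim_mul, ih]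

theorem logDim_le_of_dvd {m n : ℕ+} (h : m ∣ n) : logDim m ≤ logDim n := by
  obtain ⟨k, rfl⟩ := h
  rw [logDim_mul]
  exact le_self_add

/-- The inclusion of vectors of natural numbers in vectors of integers. -/
def castVec : (ℕ →₀ ℕ) →+ (ℕ →₀ ℤ) := Finsupp.mapRange.addMonoidHom (Nat.castAddMonoidHom ℤ)

theorem castVec_injective : Function.Injective castVec := fun a b h => by
  ext i
  exact Nat.cast_injective (R := ℤ) (DFunLike.congr_fun h i)

/-! ### The class of a spin system in coarse homology -/

section CoarseClass

variable {R : Type u} [CommRing R] {X : Type v} [MetricSpace X]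

namespace SpinSystem

/-- The coarse chain of prime exponents of the dimensions of a spin system. -/
def logChain (q : SpinSystem R X) : CC₀ X (ℕ →₀ ℤ) :=
  ⟨fun x => castVec (logDim (q.dim x)), fun Y hY => (q.locallyFinite Y hY).subset fun x hx =>
    ⟨hx.1, one_lt_of_logDim_ne_zero fun h => hx.2 (by
      change castVec (logDim (q.dim x)) = 0
      rw [h, map_zero])⟩⟩

theorem logChain_apply (q : SpinSystem R X) (x : X) :
    (q.logChain : X → ℕ →₀ ℤ) x = castVec (logDim (q.dim x)) := rfl

theorem logChain_mul (q r : SpinSystem R X) : (q * r).logChain = q.logChain + r.logChain := by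
  apply Subtype.ext
  funext x
  rw [AddSubgroup.coe_add, Pi.add_apply, logChain_apply, logChain_apply, logChain_apply, mul_dim,
    logDim_mul, map_add]

theorem logChain_one : (1 : SpinSystem R X).logChain = 0 := by
  apply Subtype.ext
  funext x
  change castVec (logDim 1) = 0
  rw [logDim_one, map_zero]

theorem finite_logDim (q : SpinSystem R X) {Y : Set X} (hY : Bornology.IsBounded Y) :
    {y | y ∈ Y ∧ logDim (q.dim y) ≠ 0}.Finite :=
  (q.locallyFinite Y hY).subset fun y hy =>
    ⟨hy.1, one_lt_of_logDim_ne_zero hy.2⟩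

/-- Divisibility of products bounds sums of `i`-th exponents, which is the counting condition for
transport. The radius `l` does not depend on the prime `i`. -/
theorem exists_transport_of_dvd {q r : SpinSystem R X} {l : ℝ}
    (h : ∀ Γ : Finset X, ∃ Γ' : Finset X, (∀ y ∈ Γ', ∃ x ∈ Γ, dist x y ≤ l) ∧
      ∏ x ∈ Γ, q.dim x ∣ ∏ x ∈ Γ', r.dim x)
    (h' : ∀ Γ : Finset X, ∃ Γ' : Finset X, (∀ y ∈ Γ', ∃ x ∈ Γ, dist x y ≤ l) ∧
      ∏ x ∈ Γ, r.dim x ∣ ∏ x ∈ Γ', q.dim x) (i : ℕ) :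
    ∃ c : X → X → ℕ, (∀ x y, c x y ≠ 0 → dist x y ≤ l) ∧ (∀ x y, c x y ≤ logDim (q.dim x) i) ∧
      (∀ x y, c x y ≤ logDim (r.dim y) i) ∧ (∀ x, ∑ᶠ y, c x y = logDim (q.dim x) i) ∧
        ∀ y, ∑ᶠ x, c x y = logDim (r.dim y) i := by
  have hfin (s : SpinSystem R X) (x : X) :
      {y | dist x y ≤ l ∧ logDim (s.dim y) i ≠ 0}.Finite :=
    (s.finite_logDim (Metric.isBounded_closedBall (x := x) (r := l))).subset fun _ hy =>
      ⟨by rw [Metric.mem_closedBall, dist_comm]; exact hy.1, fun h => hy.2 (by rw [h]; rfl)⟩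
  have hle (s t : SpinSystem R X) (Γ Γ' : Finset X) (h : ∏ x ∈ Γ, s.dim x ∣ ∏ x ∈ Γ', t.dim x) :
      ∑ x ∈ Γ, logDim (s.dim x) i ≤ ∑ x ∈ Γ', logDim (t.dim x) i := by
    have := logDim_le_of_dvd h i
    rwa [logDim_prod, logDim_prod, Finsupp.finsetSum_apply, Finsupp.finsetSum_apply] at this
  refine exists_transport (hfin q) (hfin r) (fun Γ => ?_) fun Γ => ?_
  · obtain ⟨Γ', h1, h2⟩ := h Γ
    exact ⟨Γ', h1, hle _ _ _ _ h2⟩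
  · obtain ⟨Γ', h1, h2⟩ := h' Γ
    exact ⟨Γ', h1, hle _ _ _ _ h2⟩

theorem logChain_sub_mem_of_dvd {q r : SpinSystem R X} {l : ℝ} (hl : 0 < l)
    (h : ∀ Γ : Finset X, ∃ Γ' : Finset X, (∀ y ∈ Γ', ∃ x ∈ Γ, dist x y ≤ l) ∧
      ∏ x ∈ Γ, q.dim x ∣ ∏ x ∈ Γ', r.dim x)
    (h' : ∀ Γ : Finset X, ∃ Γ' : Finset X, (∀ y ∈ Γ', ∃ x ∈ Γ, dist x y ≤ l) ∧
      ∏ x ∈ Γ, r.dim x ∣ ∏ x ∈ Γ', q.dim x) :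
    r.logChain - q.logChain ∈ (boundary X (ℕ →₀ ℤ)).range := by
  choose c hcl hcq hcr hq hr using exists_transport_of_dvd h h'
  -- The transports for the separate primes form one vector. It is finitely supported because only
  -- primes dividing `q.dim p.1` can occur.
  let C : X × X → ℕ →₀ ℕ := fun p => Finsupp.ofSupportFinite (fun i => c i p.1 p.2)
    ((logDim (q.dim p.1)).hasFiniteSupport.subset fun i hi h0 =>
      hi (Nat.le_zero.1 ((hcq i p.1 p.2).trans h0.le)))
  have hC (p i) : C p i = c i p.1 p.2 := rfl
  have hC0 (p) (hp : castVec (C p) ≠ 0) :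
      dist p.1 p.2 ≤ l ∧ logDim (q.dim p.1) ≠ 0 ∧ logDim (r.dim p.2) ≠ 0 := by
    have : C p ≠ 0 := fun h => hp (by rw [h, map_zero])
    obtain ⟨i, hi⟩ := Finsupp.ne_iff.1 this
    rw [hC, Finsupp.zero_apply] at hi
    refine ⟨hcl i _ _ hi, fun h => hi (Nat.le_zero.1 ((hcq i p.1 p.2).trans ?_)),
      fun h => hi (Nat.le_zero.1 ((hcr i p.1 p.2).trans ?_))⟩ <;> rw [h] <;> rfl
  -- Both ends of a nonzero term meeting `Y` are nontrivial sites in the `l`-thickening of `Y`,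
  -- leaving finitely many terms. The radius `l + 1` is needed because `Metric.thickening` uses a
  -- strict inequality.
  have hmem : (fun p => castVec (C p)) ∈ CC₁ X (ℕ →₀ ℤ) := by
    refine ⟨fun Y hY => ?_, l + 1, by positivity, fun p hp => ?_⟩
    · have hY' : Bornology.IsBounded (Metric.cthickening l Y) := hY.cthickening
      refine ((q.finite_logDim hY').prod (r.finite_logDim hY')).subset fun p hp => ?_
      obtain ⟨h1, h2, h3⟩ := hC0 p hp.2
      have h4 : p.1 ∈ Metric.cthickening l Y ∧ p.2 ∈ Metric.cthickening l Y := by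
        rcases hp.1 with h | h
        · exact ⟨Metric.self_subset_cthickening Y h,
            Metric.mem_cthickening_of_dist_le _ _ _ _ h (by rwa [dist_comm])⟩
        · exact ⟨Metric.mem_cthickening_of_dist_le _ _ _ _ h h1,
            Metric.self_subset_cthickening Y h⟩
      exact ⟨⟨h4.1, h2⟩, h4.2, h3⟩
    · rw [Metric.mem_thickening_iff]
      refine ⟨(p.1, p.1), rfl, ?_⟩
      rw [Prod.dist_eq, dist_self, dist_comm]
      exact (max_le hl.le (hC0 p hp).1).trans_lt (lt_add_one l)
  have hval (f : X → ℕ →₀ ℕ) (g : X → ℕ → ℕ) (hfg : ∀ x i, f x i = g x i) (e : ℕ →₀ ℕ)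
      (hf : (Function.support fun x => castVec (f x)).Finite) (he : ∀ i, ∑ᶠ x, g x i = e i) :
      ∑ᶠ x, castVec (f x) = castVec e := by
    have hf' : (Function.support f).Finite := hf.subset fun x hx h =>
      hx (castVec_injective (h.trans (map_zero castVec).symm))
    rw [← AddMonoidHom.map_finsum _ hf']
    congr 1
    ext i
    rw [← he i, ← Finsupp.applyAddHom_apply, AddMonoidHom.map_finsum _ hf']
    exact finsum_congr fun x => hfg x i
  refine ⟨⟨_, hmem⟩, ?_⟩
  apply Subtype.ext
  funext x
  change ∑ᶠ y, castVec (C (y, x)) - ∑ᶠ y, castVec (C (x, y)) =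
    castVec (logDim (r.dim x)) - castVec (logDim (q.dim x))
  rw [hval (fun y => C (y, x)) (fun y i => c i y x) (fun _ _ => rfl) _
    (CC₁.finite_snd ⟨_, hmem⟩ x) fun i => hr i x,
    hval (fun y => C (x, y)) (fun y i => c i x y) (fun _ _ => rfl) _
    (CC₁.finite_fst ⟨_, hmem⟩ x) fun i => hq i x]

theorem logChain_sub_mem_of_iso [Nontrivial R] {q r : SpinSystem R X} (e : q ≅ r) :
    r.logChain - q.logChain ∈ (boundary X (ℕ →₀ ℤ)).range := by
  obtain ⟨l, hl, h⟩ := e.hom.finiteSpread.exists_prod_dvd_prod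
  obtain ⟨l', hl', h'⟩ := e.inv.finiteSpread.exists_prod_dvd_prod
  refine logChain_sub_mem_of_dvd (lt_max_of_lt_left hl : 0 < max l l') (fun Γ => ?_) fun Γ => ?_
  · obtain ⟨Γ', h1, h2⟩ := h Γ
    refine ⟨Γ', fun y hy => ?_, h2⟩
    obtain ⟨x, hx, hxy⟩ := h1 y hy
    exact ⟨x, hx, hxy.trans (le_max_left _ _)⟩
  · obtain ⟨Γ', h1, h2⟩ := h' Γ
    refine ⟨Γ', fun y hy => ?_, h2⟩
    obtain ⟨x, hx, hxy⟩ := h1 y hy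
    exact ⟨x, hx, hxy.trans (le_max_right _ _)⟩

end SpinSystem

end CoarseClass

/-! ### Regrouping tensor factors -/

theorem liftFin_mem {R : Type u} [CommRing R] {ι : Type v} {A : ι → Type w} [∀ i, Ring (A i)]
    [∀ i, Algebra R (A i)] [Fintype ι] {S : Type*} [Ring S] [Algebra R S] (f : ∀ i, A i →ₐ[R] S)
    (hf : Pairwise fun i j => ∀ a b, Commute (f i a) (f j b)) {B : Subalgebra R S}
    (hB : ∀ i a, f i a ∈ B) (t : ⨂[R] i, A i) : liftFin f hf t ∈ B := by
  have hc : Pairwise fun i j => ∀ a b,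
      Commute ((f i).codRestrict B (hB i) a) ((f j).codRestrict B (hB j) b) :=
    fun i j hij a b => Subtype.ext (hf hij a b)
  have : liftFin f hf = B.val.comp (liftFin (fun i => (f i).codRestrict B (hB i)) hc) :=
    algHom_ext fun i a => (liftFin_single f hf i a).trans
      (congrArg B.val (liftFin_single (fun i => (f i).codRestrict B (hB i)) hc i a)).symm
  rw [this]
  exact Subtype.property _

section Regroup

variable {R : Type u} [CommRing R] {X Z : Type v} {A : Z → Type w} {B : X → Type w}
  [∀ z, Ring (A z)] [∀ z, Algebra R (A z)] [∀ x, Ring (B x)] [∀ x, Algebra R (B x)] {f : Z → X}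
  (φ : ∀ x, (⨂[R] z : {z // f z = x}, A z) ≃ₐ[R] B x)

/-- The fibre type depends on the base point; this allows factors whose indices have equal images to
be compared inside a single fibre. -/
theorem site_regroup (z : Z) {x : X} (h : f z = x) (a : A z) :
    site R B (f z) (φ (f z) (single (A := fun z : {w // f w = f z} => A z) ⟨z, rfl⟩ a)) =
      site R B x (φ x (single (A := fun z : {w // f w = x} => A z) ⟨z, h⟩ a)) := by
  subst h
  rfl

/-- The homomorphism `⨂_z A z → ⨂_x B x` induced by isomorphisms `⨂_{f z = x} A z ≃ B x`. -/
def regroupHom : InfTensor R A →ₐ[R] InfTensor R B :=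
  liftInf (fun z => (site R B (f z)).comp ((φ (f z)).toAlgHom.comp
    (single (A := fun z : {w // f w = f z} => A z) ⟨z, rfl⟩))) fun z w h a b => by
      -- Factors landing on the same site commute already in the tensor product over that fibre.
      by_cases hf : f z = f w
      · have h1 := ((commute_single (A := fun z : {z // f z = f w} => A z) (i := ⟨z, hf⟩)
          (j := ⟨w, rfl⟩) (fun e => h (congrArg Subtype.val e)) a b).map (φ (f w))).map
            (site R B (f w))
        rw [← site_regroup φ z hf] at h1
        exact h1
      · exact commute_site R B hf _ _

theorem regroupHom_site (z : Z) {x : X} (h : f z = x) (a : A z) :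
    regroupHom φ (site R A z a) =
      site R B x (φ x (single (A := fun z : {w // f w = x} => A z) ⟨z, h⟩ a)) :=
  (liftInf_site R A _ _ z a).trans (site_regroup φ z h a)

variable [∀ x, Finite {z // f z = x}]

variable (R A f) in
/-- The inclusion of the tensor factors over a finite fibre of `f`. -/
def fiberHom (x : X) : (⨂[R] z : {z // f z = x}, A z) →ₐ[R] InfTensor R A :=
  letI := Fintype.ofFinite {z // f z = x}
  liftFin (fun z : {z // f z = x} => site R A z)
    fun _ _ h => commute_site R A fun e => h (Subtype.ext e)

theorem fiberHom_single {x : X} (z : {z // f z = x}) (a : A z) :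
    fiberHom R A f x (single (A := fun z : {w // f w = x} => A z) z a) = site R A z a :=
  letI := Fintype.ofFinite {z // f z = x}
  liftFin_single (fun z : {z // f z = x} => site R A z) _ z a

theorem fiberHom_mem (x : X) (t : ⨂[R] z : {z // f z = x}, A z) :
    fiberHom R A f x t ∈ supportedOn R A (f ⁻¹' {x}) :=
  letI := Fintype.ofFinite {z // f z = x}
  liftFin_mem _ _ (fun z a => range_site_le R A z.2 ⟨a, rfl⟩) t

/-- The inverse of `regroupHom`. -/
def regroupInv : InfTensor R B →ₐ[R] InfTensor R A :=
  liftInf (fun x => (fiberHom R A f x).comp (φ x).symm.toAlgHom) fun x y h _ _ =>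
    commute_of_disjoint (Disjoint.preimage f (Set.disjoint_singleton.2 h))
      (fiberHom_mem x _) (fiberHom_mem y _)

theorem regroupInv_site (x : X) (b : B x) :
    regroupInv φ (site R B x b) = fiberHom R A f x ((φ x).symm b) :=
  liftInf_site R B _ _ x b

theorem regroupHom_fiberHom (x : X) (t : ⨂[R] z : {z // f z = x}, A z) :
    regroupHom φ (fiberHom R A f x t) = site R B x (φ x t) := by
  have : (regroupHom φ).comp (fiberHom R A f x) = (site R B x).comp (φ x).toAlgHom :=
    algHom_ext fun z a => (congrArg _ (fiberHom_single z a)).trans (regroupHom_site φ z.1 z.2 a)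
  exact DFunLike.congr_fun this t

/-- The isomorphism `⨂_z A z ≃ ⨂_x B x` induced by isomorphisms `⨂_{f z = x} A z ≃ B x`. -/
def regroup : InfTensor R A ≃ₐ[R] InfTensor R B :=
  AlgEquiv.ofAlgHom (regroupHom φ) (regroupInv φ)
    (infTensor_ext fun x b => by
      rw [AlgHom.comp_apply, regroupInv_site, regroupHom_fiberHom, AlgEquiv.apply_symm_apply,
        AlgHom.id_apply])
    (infTensor_ext fun z a => by
      rw [AlgHom.comp_apply, regroupHom_site φ z rfl, regroupInv_site, AlgEquiv.symm_apply_apply,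
        fiberHom_single, AlgHom.id_apply])

theorem regroup_site_mem (z : Z) (a : A z) :
    regroup φ (site R A z a) ∈ supportedOn R B {f z} := by
  change regroupHom φ (site R A z a) ∈ supportedOn R B {f z}
  rw [regroupHom_site φ z rfl]
  exact range_site_le R B (Set.mem_singleton _) (AlgHom.mem_range_self _ _)

theorem regroup_symm_site_mem (x : X) (b : B x) :
    (regroup φ).symm (site R B x b) ∈ supportedOn R A (f ⁻¹' {x}) := by
  change regroupInv φ (site R B x b) ∈ supportedOn R A (f ⁻¹' {x})
  rw [regroupInv_site]
  exact fiberHom_mem x _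

end Regroup

/-! ### Pushforward of spin systems -/

namespace SpinSystem

variable {R : Type u} [CommRing R] {X : Type v} [MetricSpace X] {Z : Type v}

variable (R) in
/-- The spin system whose dimension at `x` is the product of the dimensions `D z`, `f z = x`. -/
def push (f : Z → X) (hf : ∀ Y, Bornology.IsBounded Y → (f ⁻¹' Y).Finite) (D : Z → ℕ+) :
    SpinSystem R X where
  dim x := ∏ᶠ z : {z // f z = x}, D z
  locallyFinite Y hY := ((hf Y hY).image f).subset fun x hx => by
    by_contra h
    have : IsEmpty {z // f z = x} := ⟨fun z => h ⟨z, by simpa [z.2] using hx.1, z.2⟩⟩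
    have h1 := hx.2
    simp [finprod_of_isEmpty] at h1

variable {f g : Z → X} (hf : ∀ Y, Bornology.IsBounded Y → (f ⁻¹' Y).Finite)
  (hg : ∀ Y, Bornology.IsBounded Y → (g ⁻¹' Y).Finite) (D : Z → ℕ+)

theorem finite_fiber {f : Z → X} (hf : ∀ Y, Bornology.IsBounded Y → (f ⁻¹' Y).Finite)
    (x : X) : Finite {z // f z = x} :=
  (hf {x} Bornology.isBounded_singleton).to_subtype

variable (R) in
theorem castVec_logDim_push (x : X) : castVec (logDim ((push R f hf D).dim x)) =
    ∑ᶠ z : {z // f z = x}, castVec (logDim (D z)) := by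
  have := finite_fiber hf x
  have := Fintype.ofFinite {z // f z = x}
  change castVec (logDim (∏ᶠ z : {z // f z = x}, D z)) = _
  rw [finprod_eq_prod_of_fintype, finsum_eq_sum_of_fintype, logDim_prod, map_sum]

variable (R) in
/-- The isomorphism of the infinite tensor product `⨂_z Mat(R^{D z})` with the observables of its
pushforward. -/
def pushEquiv : InfTensor R (matrixFamily R D) ≃ₐ[R] (push R f hf D).observables :=
  haveI := finite_fiber hf
  regroup (f := f) fun x =>
    letI := Classical.decEq {z // f z = x}
    letI := Fintype.ofFinite {z // f z = x}
    piKronecker R (fun z : {z // f z = x} => (D z : ℕ)) ((push R f hf D).dim x) (by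
      change _ = PNat.coeMonoidHom (∏ᶠ z : {z // f z = x}, D z)
      rw [finprod_eq_prod_of_fintype, map_prod]
      rfl)

-- An observable at `x` comes from the factors `z` with `f z = x`, and these are placed by `g` at
-- points within `l` of `x`.
variable {D} in
theorem finiteSpread_push {l : ℝ} (hl : 0 < l) (h : ∀ z, dist (f z) (g z) ≤ l) :
    FiniteSpread ((pushEquiv R hf D).symm.trans (pushEquiv R hg D)).toAlgHom := by
  refine ⟨l, hl, fun x a => ?_⟩
  have key : supportedOn R (matrixFamily R D) (f ⁻¹' {x}) ≤
      (supportedOn R (push R g hg D).siteAlgebra (Metric.closedBall x l)).comap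
        (pushEquiv R hg D).toAlgHom := by
    refine supportedOn_le R _ fun z hz => ?_
    rintro _ ⟨b, rfl⟩
    have hz' : f z = x := hz
    have := finite_fiber hg
    refine supportedOn_mono R _ ?_ (regroup_site_mem (f := g) _ z b)
    rw [Set.singleton_subset_iff, Metric.mem_closedBall, dist_comm, ← hz']
    exact h z
  have := finite_fiber hf
  exact key (regroup_symm_site_mem (f := f) _ x a)

theorem symm_trans_trans_symm_trans {R A B C : Type*} [CommSemiring R] [Semiring A] [Semiring B]
    [Semiring C] [Algebra R A] [Algebra R B] [Algebra R C] (e : A ≃ₐ[R] B) (e' : A ≃ₐ[R] C) :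
    (e.symm.trans e').trans (e'.symm.trans e) = AlgEquiv.refl :=
  AlgEquiv.ext fun a => by simp

variable (R) in
/-- The pushforwards along maps of finite distance are isomorphic. -/
def pushIso {l : ℝ} (hl : 0 < l) (h : ∀ z, dist (f z) (g z) ≤ l) :
    push R f hf D ≅ push R g hg D where
  hom := ⟨_, finiteSpread_push (D := D) hf hg hl h⟩
  inv := ⟨_, finiteSpread_push (D := D) hg hf hl fun z => by rw [dist_comm]; exact h z⟩
  hom_inv_id := LocalIso.ext (symm_trans_trans_symm_trans _ _)
  inv_hom_id := LocalIso.ext (symm_trans_trans_symm_trans _ _)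

end SpinSystem

/-! ### Positive and negative parts -/

/-- The positive part of a vector of integers. -/
def posPart (e : ℕ →₀ ℤ) : ℕ →₀ ℕ := e.mapRange Int.toNat rfl

theorem castVec_posPart_sub (e : ℕ →₀ ℤ) : castVec (posPart e) - castVec (posPart (-e)) = e := by
  ext i
  exact Int.toNat_sub_toNat_neg (e i)

@[simp]
theorem posPart_zero : posPart 0 = 0 := Finsupp.mapRange_zero

theorem finsum_posPart_sub {Z X : Type*} {f : Z → X} (x : X) [Finite {z // f z = x}]
    (c : Z → ℕ →₀ ℤ) :
    ∑ᶠ z : {z // f z = x}, castVec (logDim (expDim (posPart (c z)))) -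
      ∑ᶠ z : {z // f z = x}, castVec (logDim (expDim (posPart (-c z)))) =
        ∑ᶠ z : {z // f z = x}, c z := by
  rw [← finsum_sub_distrib (Set.toFinite _) (Set.toFinite _)]
  exact finsum_congr fun z => by rw [logDim_expDim, logDim_expDim, castVec_posPart_sub]

theorem finsum_comp_of_support_subset {ι α M : Type*} [AddCommMonoid M] {j : ι → α}
    (hj : Function.Injective j) {g : α → M} (h : Function.support g ⊆ Set.range j) :
    ∑ᶠ i, g (j i) = ∑ᶠ a, g a := by
  rw [← finsum_mem_range hj, ← finsum_mem_inter_support, Set.inter_eq_right.2 h,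
    finsum_mem_support]

section Comparison

variable {R : Type u} [CommRing R] {X : Type v} [MetricSpace X]

namespace SpinSystem

/-- The positive and negative parts of `c` are exponent vectors of positive integers, and both
vanish wherever `c` does. -/
theorem exists_logChain_sub_eq (c : CC₀ X (ℕ →₀ ℤ)) :
    ∃ q r : SpinSystem R X, q.logChain - r.logChain = c := by
  refine ⟨⟨fun x => expDim (posPart (c.1 x)), fun Y hY => (c.2 Y hY).subset fun x hx =>
    ⟨hx.1, fun h => ?_⟩⟩, ⟨fun x => expDim (posPart (-c.1 x)), fun Y hY =>
      (c.2 Y hY).subset fun x hx => ⟨hx.1, fun h => ?_⟩⟩, ?_⟩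
  · have h1 := hx.2
    rw [Set.mem_ofPred_eq, h, posPart_zero, ← logDim_one, expDim_logDim] at h1
    exact lt_irrefl _ h1
  · have h1 := hx.2
    rw [Set.mem_ofPred_eq, h, neg_zero, posPart_zero, ← logDim_one, expDim_logDim] at h1
    exact lt_irrefl _ h1
  · apply Subtype.ext
    funext x
    change castVec (logDim (expDim (posPart (c.1 x)))) -
      castVec (logDim (expDim (posPart (-c.1 x)))) = c.1 x
    rw [logDim_expDim, logDim_expDim, castVec_posPart_sub]

/-- If `∂c = q - r` on chains, the edges of `c` describe how to slide matrix factors. A positive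
exponent moves from the start of its edge to the end and a negative one moves backwards. The total
before is `s`, the total after is `t`, and their chains satisfy `t - s = ∂c`. -/
theorem exists_mul_eq_mul {q r : SpinSystem R X}
    (h : q.logChain - r.logChain ∈ (boundary X (ℕ →₀ ℤ)).range) :
    ∃ s t : SpinSystem R X, Nonempty (s ≅ t) ∧ q * s = r * t := by
  obtain ⟨c, hc⟩ := h
  obtain ⟨hfin, l, hl, hcl⟩ := c.2
  let Z := {p : X × X // c.1 p ≠ 0}
  let f : Z → X := fun z => z.1.1
  let g : Z → X := fun z => z.1.2
  have hf (Y : Set X) (hY : Bornology.IsBounded Y) : (f ⁻¹' Y).Finite :=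
    ((hfin Y hY).preimage Subtype.val_injective.injOn).subset fun z hz => ⟨Or.inl hz, z.2⟩
  have hg (Y : Set X) (hY : Bornology.IsBounded Y) : (g ⁻¹' Y).Finite :=
    ((hfin Y hY).preimage Subtype.val_injective.injOn).subset fun z hz => ⟨Or.inr hz, z.2⟩
  -- In the maximum metric, a diagonal point within `l` of an edge is within `l` of both its ends.
  have hd (z : Z) : dist (f z) (g z) ≤ 2 * l := by
    obtain ⟨w, hw, hwz⟩ := Metric.mem_thickening_iff.1 (hcl z.1 z.2)
    rw [Set.mem_diagonal_iff] at hw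
    have h1 := (le_max_left _ _).trans_lt (Prod.dist_eq.symm.trans_lt hwz)
    have h2 := (le_max_right _ _).trans_lt (Prod.dist_eq.symm.trans_lt hwz)
    have h3 := dist_triangle_right (f z) (g z) w.1
    rw [← hw] at h2
    change dist (f z) w.1 < l at h1
    change dist (g z) w.1 < l at h2
    linarith
  let D : Z → ℕ+ := fun z => expDim (posPart (c.1 z.1))
  let E : Z → ℕ+ := fun z => expDim (posPart (-c.1 z.1))
  have hl2 : 0 < 2 * l := by positivity
  refine ⟨push R f hf D * push R g hg E, push R g hg D * push R f hf E,
    ⟨stackIso (pushIso R hf hg D hl2 hd) (pushIso R hf hg E hl2 hd).symm⟩, ?_⟩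
  -- Dimensions are determined by their integer exponent vectors, so the equality of systems can be
  -- checked additively at each site.
  refine SpinSystem.ext (funext fun x => logDim_injective (castVec_injective ?_))
  simp only [mul_dim, logDim_mul, map_add, castVec_logDim_push]
  have := finite_fiber hf x
  have := finite_fiber hg x
  have h1 := finsum_posPart_sub (f := f) x fun z => c.1 z.1
  have h2 := finsum_posPart_sub (f := g) x fun z => c.1 z.1
  have h3 : ∑ᶠ z : {z // f z = x}, c.1 z.1.1 = ∑ᶠ y, c.1 (x, y) := by
    rw [← finsum_comp_of_support_subset (j := fun z : {z // f z = x} => z.1.1.2)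
      (fun z w h => Subtype.ext (Subtype.ext (Prod.ext (z.2.trans w.2.symm) h)))
      fun y hy => ⟨⟨⟨(x, y), hy⟩, rfl⟩, rfl⟩]
    exact finsum_congr fun z => congrArg c.1 (Prod.ext z.2 rfl)
  have h4 : ∑ᶠ z : {z // g z = x}, c.1 z.1.1 = ∑ᶠ y, c.1 (y, x) := by
    rw [← finsum_comp_of_support_subset (j := fun z : {z // g z = x} => z.1.1.1)
      (fun z w h => Subtype.ext (Subtype.ext (Prod.ext h (z.2.trans w.2.symm))))
      fun y hy => ⟨⟨⟨(y, x), hy⟩, rfl⟩, rfl⟩]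
    exact finsum_congr fun z => congrArg c.1 (Prod.ext rfl z.2)
  have h5 : ∑ᶠ y, c.1 (y, x) - ∑ᶠ y, c.1 (x, y) =
      castVec (logDim (q.dim x)) - castVec (logDim (r.dim x)) :=
    congrFun (congrArg Subtype.val hc) x
  rw [← h3, ← h4, ← h1, ← h2] at h5
  rw [← sub_eq_zero] at h5 ⊢
  rw [← neg_eq_zero, ← h5]
  simp only [D, E]
  abel

end SpinSystem

/-! ### The isomorphism -/

variable (R X)

/-- The homomorphism from isomorphism classes of spin systems to coarse homology. -/
def classHom [Nontrivial R] : IsoClasses R X →* Multiplicative (CH₀ X (ℕ →₀ ℤ)) :=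
  (SpinSystem.isoCon R X).lift
    { toFun := fun q => Multiplicative.ofAdd (QuotientAddGroup.mk q.logChain)
      map_one' := by
        rw [SpinSystem.logChain_one]
        rfl
      map_mul' := fun q r => by
        rw [SpinSystem.logChain_mul]
        rfl }
    fun q r ⟨e⟩ => by
      refine congrArg Multiplicative.ofAdd (QuotientAddGroup.eq.2 ?_)
      rw [neg_add_eq_sub]
      exact SpinSystem.logChain_sub_mem_of_iso e

variable {R X}

theorem classHom_mk [Nontrivial R] (q : SpinSystem R X) :
    classHom R X ((SpinSystem.isoCon R X).mk' q) =
      Multiplicative.ofAdd (QuotientAddGroup.mk q.logChain) := rfl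

/-- The auxiliary systems `s` and `t` have the same class, which cancels in the group completion. -/
theorem of_eq_of_logChain_sub_mem {q r : SpinSystem R X}
    (h : q.logChain - r.logChain ∈ (boundary X (ℕ →₀ ℤ)).range) :
    Algebra.GrothendieckGroup.of ((SpinSystem.isoCon R X).mk' q) =
      Algebra.GrothendieckGroup.of ((SpinSystem.isoCon R X).mk' r) := by
  obtain ⟨s, t, e, hst⟩ := SpinSystem.exists_mul_eq_mul h
  have h1 : (SpinSystem.isoCon R X).mk' s = (SpinSystem.isoCon R X).mk' t :=
    (SpinSystem.isoCon R X).eq.2 e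
  have h2 := congrArg (fun q => Algebra.GrothendieckGroup.of ((SpinSystem.isoCon R X).mk' q)) hst
  simp only [map_mul, h1] at h2
  exact mul_right_cancel h2

theorem lift_classHom_bijective [Nontrivial R] :
    Function.Bijective (Algebra.GrothendieckGroup.lift (classHom R X)) := by
  have hof (a : IsoClasses R X) : Algebra.GrothendieckGroup.lift (classHom R X)
      (Algebra.GrothendieckGroup.of a) = classHom R X a :=
    DFunLike.congr_fun (Algebra.GrothendieckGroup.lift.symm_apply_apply (classHom R X)) a
  constructor
  · rw [injective_iff_map_eq_one]
    intro x hx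
    -- Every element of the group completion is a quotient of two classes, so triviality of the
    -- kernel reduces to comparing two spin systems.
    induction x using Localization.ind with | _ y
    obtain ⟨a, b, hb⟩ := y
    have hab : (Localization.mk a ⟨b, hb⟩ : K₀ R X) =
        Algebra.GrothendieckGroup.of a / Algebra.GrothendieckGroup.of b := by
      simp [Algebra.GrothendieckGroup.of, ← Localization.mk_one_eq_monoidOf_mk]
    obtain ⟨q, rfl⟩ := (SpinSystem.isoCon R X).mk'_surjective a
    obtain ⟨r, rfl⟩ := (SpinSystem.isoCon R X).mk'_surjective b
    rw [hab, map_div, hof, hof, div_eq_one, classHom_mk, classHom_mk] at hx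
    have h1 := QuotientAddGroup.eq.1 (Multiplicative.ofAdd.injective hx).symm
    rw [neg_add_eq_sub] at h1
    rw [hab, of_eq_of_logChain_sub_mem h1, div_self']
  · intro y
    obtain ⟨c, hc⟩ := QuotientAddGroup.mk_surjective y.toAdd
    obtain ⟨q, r, h⟩ := SpinSystem.exists_logChain_sub_eq (R := R) c
    refine ⟨Algebra.GrothendieckGroup.of ((SpinSystem.isoCon R X).mk' q) /
      Algebra.GrothendieckGroup.of ((SpinSystem.isoCon R X).mk' r), ?_⟩
    rw [map_div, hof, hof, classHom_mk, classHom_mk, ← ofAdd_sub, ← QuotientAddGroup.mk_sub, h, hc]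
    rfl

end Comparison

end QuantumSpin

end

/-- Let `R` be a nonzero commutative ring without nontrivial idempotents and `X` a metric space.
Then the group `K₀` of the category of quantum spin systems over `R` on `X` is isomorphic to the
`0`-th coarse homology group of `X` with coefficients in the countably infinite direct sum of
copies of `ℤ`. -/
theorem mainTheorem6 (R : Type u) [CommRing R] [Nontrivial R]
    (hR : ∀ e : R, IsIdempotentElem e → e = 0 ∨ e = 1) (X : Type v) [MetricSpace X] :
    Nonempty (Additive (QuantumSpin.K₀ R X) ≃+ QuantumSpin.CH₀ X (ℕ →₀ ℤ)) :=
  ⟨AddEquiv.toMultiplicativeRight.symm (MulEquiv.ofBijective _ QuantumSpin.lift_classHom_bijective)⟩
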